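/- Let $k\ge 1$ and $a_i,b_i,c_i\in\mathbb C$ $(1\le i\le k)$ with $b_i=c_i$ for all $i$, and extend these numbers $k$-periodically. Let $T(f)$ be the bounded operator on $\ell^2(\mathbb N)$ given by the semi-infinite symmetric tridiagonal $k$-Toeplitz matrix with $T_{i,i}=a_i$, $T_{i,i+1}=b_i$, $T_{i+1,i}=c_i$ and all other entries $0$. Write it as a block tridiagonal block Toeplitz matrix with $k\times k$ blocks $A_0$ on, $A_{-1}$ to the right of, and $A_1$ below the diagonal, let $$f(z)=A_{-1}z^{-1}+A_0+A_1z\qquad(z\neq 0)$$ be its symbol, and let $B_0$ be the leading principal $(k-1)\times(k-1)$ submatrix of $A_0$. Let $$\sigma_{\det}(f)=\{\lambda\in\mathbb C:\ \det(f(z)-\lambda)=0\text{ for some }|z|=1\}.$$ If all $b_i\ne 0$, then $z\mapsto z\det(f(z)-\lambda)$ is a polynomial of degree $2$ for each $\lambda$; let $z_1(\lambda),z_2(\lambda)$ be its roots and $\Gamma=\{\lambda\in\mathbb C:|z_1(\lambda)|=|z_2(\lambda)|\}$. The essential spectrum $\sigma_{\mathrm{ess}}(T(f))$ is the set of $\lambda$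 for which $T(f)-\lambda$ is not Fredholm. An edge mode of $T(f)$ with edge eigenvalue $\lambda\in\mathbb C\setminus\sigma_{\mathrm{ess}}(T(f))$ is a nonzero, exponentially decaying $w\in\ell^2(\mathbb N)$ with $T(f)w=\lambda w$; $\sigma_{\mathrm{edge}}(T(f))$ is the set of edge eigenvalues. Then: (i) Suppose all $b_i\neq0$. For every $\lambda\in\sigma(B_0)\setminus\Gamma$ there are $z(\lambda)\in\mathbb C\setminus\{0\}$ and $v\in\mathbb C^k\setminus\{0\}$ with $$[f(z(\lambda))-\lambda]\,v=0,\qquad v_k=0. \tag{1}$$ (ii) Suppose all $b_i\neq0$. If $\lambda\in\sigma(B_0)\setminus\Gamma$ and $z(\lambda)\neq 0$, $v\neq0$ satisfy (1) with $|z(\lambda)|>1$, then $\lambda\in\sigma_{\mathrm{edge}}(T(f))$; more precisely, the quasi-periodic extension $w=(v^\top,z(\lambda)^{-1}v^\top,z(\lambda)^{-2}v^\top,\dots)$ lies in $\ell^2(\mathbb N)$ and is an edge mode of $T(f)$ with edge eigenvalue $\lambda$. (iii) $\sigma_{\mathrm{edge}}(T(f))\subseteq\sigma(T(f))$, $\sigma_{\mathrm{edge}}(T(f))\subseteq\sigma(B_0)$,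 and $$\sigma(T(f))=\sigma_{\det}(f)\cup\sigma_{\mathrm{edge}}(T(f)).$$ -/

import Mathlib

open scoped ENNReal Matrix

noncomputable section

/-- The Hilbert space `ℓ²(ℕ, ℂ)` of complex square-summable sequences (indexed from `0`). -/
abbrev EllTwo : Type := lp (fun _ : ℕ => ℂ) 2

/-- The entries of the semi-infinite tridiagonal matrix with `k`-periodic diagonal `a`,
super-diagonal `b` and sub-diagonal `c`. All indices start at `0`. -/
def tridiagEntry {k : ℕ} [NeZero k] (a b c : Fin k → ℂ) (i j : ℕ) : ℂ :=
  if j = i then a (Fin.ofNat k i)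
  else if j = i + 1 then b (Fin.ofNat k i)
  else if i = j + 1 then c (Fin.ofNat k j)
  else 0

/-- The product of the semi-infinite tridiagonal matrix with a sequence; row `i` has no nonzero
entries beyond column `i + 1`, so the sum over the row is finite. -/
def tridiagMulVec {k : ℕ} [NeZero k] (a b c : Fin k → ℂ) (x : ℕ → ℂ) (i : ℕ) : ℂ :=
  ∑ j ∈ Finset.range (i + 2), tridiagEntry a b c i j * x j

theorem tridiagEntry_of_lt {k : ℕ} [NeZero k] (a b c : Fin k → ℂ) {i j : ℕ} (h : i + 1 < j) :
    tridiagEntry a b c i j = 0 := by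
  unfold tridiagEntry
  rw [if_neg (by omega), if_neg (by omega), if_neg (by omega)]

theorem tridiagEntry_of_gt {k : ℕ} [NeZero k] (a b c : Fin k → ℂ) {i j : ℕ} (h : j + 1 < i) :
    tridiagEntry a b c i j = 0 := by
  unfold tridiagEntry
  rw [if_neg (by omega), if_neg (by omega), if_neg (by omega)]

theorem tridiagMulVec_zero {k : ℕ} [NeZero k] (a b c : Fin k → ℂ) (x : ℕ → ℂ) :
    tridiagMulVec a b c x 0 = a (Fin.ofNat k 0) * x 0 + b (Fin.ofNat k 0) * x 1 := by
  simp [tridiagMulVec, tridiagEntry, Finset.sum_range_succ]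

theorem tridiagMulVec_succ {k : ℕ} [NeZero k] (a b c : Fin k → ℂ) (x : ℕ → ℂ) (i : ℕ) :
    tridiagMulVec a b c x (i + 1) =
      c (Fin.ofNat k i) * x i + a (Fin.ofNat k (i + 1)) * x (i + 1)
        + b (Fin.ofNat k (i + 1)) * x (i + 2) := by
  unfold tridiagMulVec
  rw [Finset.sum_range_succ, Finset.sum_range_succ, Finset.sum_range_succ, Finset.sum_eq_zero]
  · have h : ¬ i = i + 1 + 1 := by omega
    simp [tridiagEntry, h]
  · intro j hj
    rw [tridiagEntry_of_gt a b c (by simpa using hj), zero_mul]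

theorem memℓp_two_of_norm_le {M : ℝ} {x y : ℕ → ℂ} (hx : Memℓp x 2) (h : ∀ n, ‖y n‖ ≤ M * ‖x n‖) :
    Memℓp y 2 := by
  rw [memℓp_gen_iff (by norm_num)] at hx ⊢
  refine Summable.of_nonneg_of_le (fun n => by positivity) (fun n => ?_)
    (hx.mul_left (M ^ 2))
  have h1 := pow_le_pow_left₀ (norm_nonneg _) (h n) 2
  simpa [mul_pow] using h1

theorem memℓp_tridiagMulVec {k : ℕ} [NeZero k] (a b c : Fin k → ℂ) {x : ℕ → ℂ}
    (hx : Memℓp x 2) : Memℓp (tridiagMulVec a b c x) 2 := by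
  have bd : ∀ (d : Fin k → ℂ) (n : ℕ), ‖d (Fin.ofNat k n)‖ ≤ ∑ i, ‖d i‖ := fun d n =>
    Finset.single_le_sum (f := fun i => ‖d i‖) (fun i _ => norm_nonneg _) (Finset.mem_univ _)
  have hs : Summable fun n => ‖x n‖ ^ (2 : ℝ) := by
    simpa using (memℓp_gen_iff (by norm_num)).1 hx
  have hup : Memℓp (fun n => x (n + 1)) 2 := by
    rw [memℓp_gen_iff (by norm_num)]
    simpa using (summable_nat_add_iff 1).2 hs
  have hdown : Memℓp (fun n => Nat.casesOn n 0 x : ℕ → ℂ) 2 := by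
    rw [memℓp_gen_iff (by norm_num)]
    rw [← summable_nat_add_iff 1]
    simpa using hs
  have h1 : Memℓp (fun n => a (Fin.ofNat k n) * x n) 2 :=
    memℓp_two_of_norm_le (M := ∑ i, ‖a i‖) hx fun n => by
      rw [norm_mul]; gcongr; exact bd a n
  have h2 : Memℓp (fun n => b (Fin.ofNat k n) * x (n + 1)) 2 :=
    memℓp_two_of_norm_le (M := ∑ i, ‖b i‖) hup fun n => by
      rw [norm_mul]; gcongr; exact bd b n
  have h3 : Memℓp (fun n => c (Fin.ofNat k (n - 1)) * (Nat.casesOn n 0 x : ℂ)) 2 :=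
    memℓp_two_of_norm_le (M := ∑ i, ‖c i‖) hdown fun n => by
      rw [norm_mul]; gcongr; exact bd c _
  convert (h3.add h1).add h2 using 1
  funext n
  cases n with
  | zero => simp [tridiagMulVec_zero]
  | succ n => simp [tridiagMulVec_succ]

/-- The tridiagonal `k`-Toeplitz operator as a linear map on `ℓ²`. -/
def toeplitzLin {k : ℕ} [NeZero k] (a b c : Fin k → ℂ) : EllTwo →ₗ[ℂ] EllTwo where
  toFun x := ⟨tridiagMulVec a b c x, memℓp_tridiagMulVec a b c (lp.memℓp x)⟩
  map_add' x y := by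
    apply lp.ext
    funext i
    change tridiagMulVec a b c (x + y : EllTwo) i = tridiagMulVec a b c x i + tridiagMulVec a b c y i
    simp [tridiagMulVec, mul_add, Finset.sum_add_distrib]
  map_smul' r x := by
    apply lp.ext
    funext i
    change tridiagMulVec a b c (r • x : EllTwo) i = r * tridiagMulVec a b c x i
    simp [tridiagMulVec, Finset.mul_sum, mul_left_comm]

theorem continuous_toeplitzLin {k : ℕ} [NeZero k] (a b c : Fin k → ℂ) :
    Continuous (toeplitzLin a b c) := by
  have hco : ∀ {u : ℕ → EllTwo} {x : EllTwo}, Filter.Tendsto u Filter.atTop (nhds x) →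
      ∀ i, Filter.Tendsto (fun n => u n i) Filter.atTop (nhds (x i)) := by
    intro u x h i
    rw [tendsto_iff_norm_sub_tendsto_zero] at h ⊢
    refine squeeze_zero (fun _ => norm_nonneg _) (fun n => ?_) h
    exact lp.norm_apply_le_norm (by norm_num) (u n - x) i
  refine LinearMap.continuous_of_seq_closed_graph _ fun u x y hx hy => ?_
  apply lp.ext
  funext i
  refine tendsto_nhds_unique (hco hy i) ?_
  change Filter.Tendsto (fun n => tridiagMulVec a b c (u n) i) Filter.atTop
    (nhds (tridiagMulVec a b c x i))
  exact tendsto_finsetSum _ fun j _ => (hco hx j).const_mul _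

/-- The tridiagonal `k`-Toeplitz operator `T(f)`: the bounded operator on `ℓ²` given by the
semi-infinite tridiagonal matrix. -/
def toeplitzOp {k : ℕ} [NeZero k] (a b c : Fin k → ℂ) : EllTwo →L[ℂ] EllTwo :=
  ⟨toeplitzLin a b c, continuous_toeplitzLin a b c⟩

theorem toeplitzOp_apply {k : ℕ} [NeZero k] (a b c : Fin k → ℂ) (x : EllTwo) (i : ℕ) :
    toeplitzOp a b c x i = tridiagMulVec a b c x i := rfl

/-- The diagonal `k × k` block `A₀` of the tridiagonal matrix. -/
def blockZero {k : ℕ} [NeZero k] (a b c : Fin k → ℂ) : Matrix (Fin k) (Fin k) ℂ :=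
  Matrix.of fun i j => tridiagEntry a b c i j

/-- The `k × k` block `A₋₁` to the right of the diagonal block. -/
def blockNegOne {k : ℕ} [NeZero k] (a b c : Fin k → ℂ) : Matrix (Fin k) (Fin k) ℂ :=
  Matrix.of fun i j => tridiagEntry a b c i (k + j)

/-- The `k × k` block `A₁` below the diagonal block. -/
def blockOne {k : ℕ} [NeZero k] (a b c : Fin k → ℂ) : Matrix (Fin k) (Fin k) ℂ :=
  Matrix.of fun i j => tridiagEntry a b c (k + i) j

/-- The symbol `f(z) = A₋₁ z⁻¹ + A₀ + A₁ z`, meaningful for `z ≠ 0`. -/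
def symbol {k : ℕ} [NeZero k] (a b c : Fin k → ℂ) (z : ℂ) : Matrix (Fin k) (Fin k) ℂ :=
  z⁻¹ • blockNegOne a b c + blockZero a b c + z • blockOne a b c

/-- The leading principal `(k-1) × (k-1)` submatrix `B₀` of `A₀` (an empty matrix if `k = 1`). -/
def leadingBlock {k : ℕ} [NeZero k] (a b c : Fin k → ℂ) :
    Matrix (Fin (k - 1)) (Fin (k - 1)) ℂ :=
  (blockZero a b c).submatrix (Fin.castLE (Nat.sub_le k 1)) (Fin.castLE (Nat.sub_le k 1))

/-- `σ_det(f)`: the eigenvalues of the symbol on the unit circle. -/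
def sigmaDet {k : ℕ} [NeZero k] (a b c : Fin k → ℂ) : Set ℂ :=
  {l | ∃ z : ℂ, ‖z‖ = 1 ∧ (symbol a b c z - l • (1 : Matrix (Fin k) (Fin k) ℂ)).det = 0}

/-- The set `Γ` of those `l` for which the two roots `z₁, z₂` (with multiplicity) of the quadratic
polynomial `z ↦ z * det (f(z) - l)` have equal modulus. That polynomial has degree exactly two
when all `b i` and `c i` are nonzero. -/
def gammaSet {k : ℕ} [NeZero k] (a b c : Fin k → ℂ) : Set ℂ :=
  {l | ∃ z₁ z₂ q : ℂ, q ≠ 0 ∧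
    (∀ z : ℂ, z ≠ 0 →
      z * (symbol a b c z - l • (1 : Matrix (Fin k) (Fin k) ℂ)).det = q * (z - z₁) * (z - z₂)) ∧
    ‖z₁‖ = ‖z₂‖}

/-- The essential spectrum of a bounded operator on `ℓ²`: the `l` for which `T - l` is not
Fredholm. -/
def essSpectrum (T : EllTwo →L[ℂ] EllTwo) : Set ℂ :=
  {l | ¬ (T - l • ContinuousLinearMap.id ℂ EllTwo).IsFredholm}

/-- `w` is an edge mode of `T` with edge eigenvalue `l`: a nonzero exponentially decaying
eigenvector in `ℓ²` whose eigenvalue `l` lies outside the essential spectrum. -/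
def IsEdgeMode (T : EllTwo →L[ℂ] EllTwo) (l : ℂ) (w : EllTwo) : Prop :=
  w ≠ 0 ∧ l ∉ essSpectrum T ∧ T w = l • w ∧
    ∃ C ρ : ℝ, 0 < ρ ∧ ρ < 1 ∧ ∀ n : ℕ, ‖w n‖ ≤ C * ρ ^ n

/-- The set of edge eigenvalues. -/
def sigmaEdge (T : EllTwo →L[ℂ] EllTwo) : Set ℂ :=
  {l | ∃ w : EllTwo, IsEdgeMode T l w}

/-- `v` is a Bloch vector for `l` with Floquet parameter `z ≠ 0` whose last entry vanishes:
`v ≠ 0`, `[f(z) - l] v = 0` and `v_k = 0`. -/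
def IsTerminatingBloch {k : ℕ} [NeZero k] (a b c : Fin k → ℂ) (l z : ℂ) (v : Fin k → ℂ) : Prop :=
  z ≠ 0 ∧ v ≠ 0 ∧
    (symbol a b c z - l • (1 : Matrix (Fin k) (Fin k) ℂ)) *ᵥ v = 0 ∧
    v ⟨k - 1, Nat.sub_one_lt (NeZero.ne k)⟩ = 0

/-- The quasi-periodic extension `(v, z⁻¹ v, z⁻² v, …)` of `v`, as a sequence. -/
def quasiPeriodicExt {k : ℕ} [NeZero k] (z : ℂ) (v : Fin k → ℂ) (n : ℕ) : ℂ :=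
  z⁻¹ ^ (n / k) * v (Fin.ofNat k n)

end

/-! Indices start at 0 and `A = T - l`. No index theory of block Toeplitz operators is used; its
place is taken by one a priori estimate and the symmetry of the matrix.

Off `sigmaDet`, the symbol minus `l` is uniformly invertible on the unit circle. A discrete Fourier
transform over blocks then gives `‖x‖² ≤ C (‖A x‖² + ‖x 0‖²)` (`exists_norm_sq_le`), the term in `x
0` being the price of cutting the line at the origin. So `A` is bounded below on `x 0 = 0`, its
range is closed, and a kernel element is determined by its entry 0. Since the matrix is symmetric,
conjugation sends the orthogonal complement of the range into the kernel (`star_mem_ker`). Hence `A`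
is Fredholm, and it is invertible as soon as it is injective.

Now let `w ≠ 0` lie in a finite-dimensional kernel. If `b_{k-1} w_0 = 0`, shifting by whole periods
to the right would stay in the kernel forever, which finite dimension forbids
(`eq_zero_of_mem_ker`). The Wronskian of `w` and its shift by `k` is the constant `-b_{k-1} w_0
w_{k-1}` and tends to 0, so `w_{k-1} = 0`. Therefore the first `k - 1` entries form an eigenvector
of the leading block, and the left shift of `w` is again in the kernel, hence a multiple `r w`;
square summability forces `‖r‖ < 1` and exponential decay. This shows that the spectrum off
`sigmaDet` consists of edge eigenvalues. Conversely, truncated Bloch waves put `sigmaDet` into the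
spectrum.

For (i), an eigenvector of the leading block is continued by 0, and the last row is solved for `z`.
For (ii), the determinant of the symbol minus `l` has the form `α (z + z⁻¹) + β`, so a zero on the
circle makes both roots unimodular. Thus `sigmaDet` lies in `gammaSet`, and off `gammaSet` the
operator is Fredholm. -/

/-! ### Quasi-periodic sequences and the action of the symbol -/

theorem ofNat_add_self {k : ℕ} [NeZero k] (n : ℕ) : Fin.ofNat k (n + k) = Fin.ofNat k n := by
  ext; simp

theorem ofNat_mul_add {k : ℕ} [NeZero k] (m n : ℕ) :
    Fin.ofNat k (m * k + n) = Fin.ofNat k n := by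
  ext; simp

theorem ofNat_val {k : ℕ} [NeZero k] (i : Fin k) : Fin.ofNat k i = i := by
  ext; simp

theorem quasiPeriodicExt_val {k : ℕ} [NeZero k] (z : ℂ) (v : Fin k → ℂ) (i : Fin k) :
    quasiPeriodicExt z v i = v i := by
  simp [quasiPeriodicExt, Nat.div_eq_of_lt i.isLt]

theorem quasiPeriodicExt_add {k : ℕ} [NeZero k] (z : ℂ) (v : Fin k → ℂ) (n : ℕ) :
    quasiPeriodicExt z v (n + k) = z⁻¹ * quasiPeriodicExt z v n := by
  unfold quasiPeriodicExt
  rw [ofNat_add_self, Nat.add_div_right _ (Nat.pos_of_neZero k), pow_succ]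
  ring

theorem quasiPeriodicExt_mul_add {k : ℕ} [NeZero k] (z : ℂ) (v : Fin k → ℂ) (m : ℕ) (i : Fin k) :
    quasiPeriodicExt z v (m * k + i) = z⁻¹ ^ m * v i := by
  unfold quasiPeriodicExt
  rw [ofNat_mul_add, ofNat_val, add_comm, Nat.add_mul_div_right _ _ (Nat.pos_of_neZero k),
    Nat.div_eq_of_lt i.isLt, zero_add]

theorem tridiagMulVec_eq_sum {k : ℕ} [NeZero k] (a b c : Fin k → ℂ) (x : ℕ → ℂ) {i N : ℕ}
    (h : i + 2 ≤ N) :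
    tridiagMulVec a b c x i = ∑ j ∈ Finset.range N, tridiagEntry a b c i j * x j := by
  refine Finset.sum_subset (fun j hj => ?_) (fun j _ hj => ?_)
  · simp at hj ⊢; omega
  · rw [tridiagEntry_of_lt, zero_mul]
    simp at hj; omega

theorem tridiagMulVec_congr {k : ℕ} [NeZero k] (a b c : Fin k → ℂ) {x y : ℕ → ℂ} {i : ℕ}
    (h : ∀ j, i ≤ j + 1 → j ≤ i + 1 → x j = y j) :
    tridiagMulVec a b c x i = tridiagMulVec a b c y i := by
  cases i with
  | zero => rw [tridiagMulVec_zero, tridiagMulVec_zero, h 0 (by omega) (by omega),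
      h 1 (by omega) (by omega)]
  | succ i => rw [tridiagMulVec_succ, tridiagMulVec_succ, h i (by omega) (by omega),
      h (i + 1) (by omega) (by omega), h (i + 2) (by omega) (by omega)]

theorem tridiagMulVec_add {k : ℕ} [NeZero k] (a b c : Fin k → ℂ) (x y : ℕ → ℂ) (i : ℕ) :
    tridiagMulVec a b c (fun n => x n + y n) i =
      tridiagMulVec a b c x i + tridiagMulVec a b c y i := by
  simp [tridiagMulVec, mul_add, Finset.sum_add_distrib]

theorem tridiagMulVec_smul {k : ℕ} [NeZero k] (a b c : Fin k → ℂ) (r : ℂ) (x : ℕ → ℂ) (i : ℕ) :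
    tridiagMulVec a b c (fun n => r * x n) i = r * tridiagMulVec a b c x i := by
  simp [tridiagMulVec, Finset.mul_sum, mul_left_comm]

/-- The block `z⁻¹ v` to the right is part of the extension. The block `z v` to the left is not, and
only its last entry reaches row 0: this is the corner term. -/
theorem symbol_mulVec {k : ℕ} [NeZero k] (a b c : Fin k → ℂ) (z : ℂ) (v : Fin k → ℂ) (i : Fin k) :
    (symbol a b c z *ᵥ v) i = tridiagMulVec a b c (quasiPeriodicExt z v) i +
      if (i : ℕ) = 0 then z * c (Fin.ofNat k (k - 1)) * v (Fin.ofNat k (k - 1)) else 0 := by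
  have hk : 0 < k := Nat.pos_of_neZero k
  have h0 : (blockZero a b c *ᵥ v) i =
      ∑ j ∈ Finset.range k, tridiagEntry a b c i j * quasiPeriodicExt z v j := by
    rw [Finset.sum_range]
    simp [Matrix.mulVec, dotProduct, blockZero, quasiPeriodicExt_val]
  have h1 : z⁻¹ * (blockNegOne a b c *ᵥ v) i =
      ∑ j ∈ Finset.range k, tridiagEntry a b c i (k + j) * quasiPeriodicExt z v (k + j) := by
    rw [Finset.sum_range, Matrix.mulVec, dotProduct, Finset.mul_sum]
    refine Finset.sum_congr rfl fun j _ => ?_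
    rw [add_comm k (j : ℕ), quasiPeriodicExt_add, quasiPeriodicExt_val, blockNegOne,
      Matrix.of_apply, add_comm k (j : ℕ)]
    ring
  have h2 : (blockOne a b c *ᵥ v) i =
      if (i : ℕ) = 0 then c (Fin.ofNat k (k - 1)) * v (Fin.ofNat k (k - 1)) else 0 := by
    rw [Matrix.mulVec, dotProduct, Finset.sum_eq_single (Fin.ofNat k (k - 1))]
    · have hv : ((Fin.ofNat k (k - 1) : Fin k) : ℕ) = k - 1 := by
        simp [Nat.mod_eq_of_lt (show k - 1 < k by omega)]
      rw [blockOne, Matrix.of_apply, hv, tridiagEntry, if_neg (by omega), if_neg (by omega)]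
      by_cases hi : (i : ℕ) = 0
      · rw [if_pos (by omega), if_pos hi]
      · rw [if_neg (by omega), if_neg hi, zero_mul]
    · intro j _ hj
      have : (j : ℕ) ≠ k - 1 := by
        rintro h
        apply hj
        rw [← h, ofNat_val]
      have := j.isLt
      rw [blockOne, Matrix.of_apply, tridiagEntry_of_gt _ _ _ (by omega), zero_mul]
    · simp
  rw [symbol, Matrix.add_mulVec, Matrix.add_mulVec, Matrix.smul_mulVec, Matrix.smul_mulVec]
  simp only [Pi.add_apply, Pi.smul_apply, smul_eq_mul]
  rw [h0, h1, h2, tridiagMulVec_eq_sum a b c _ (show (i : ℕ) + 2 ≤ k + k by omega),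
    Finset.sum_range_add]
  split_ifs <;> ring

theorem symbol_sub_mulVec {k : ℕ} [NeZero k] (a b c : Fin k → ℂ) (z l : ℂ) (v : Fin k → ℂ)
    (i : Fin k) :
    ((symbol a b c z - l • (1 : Matrix (Fin k) (Fin k) ℂ)) *ᵥ v) i =
      tridiagMulVec a b c (quasiPeriodicExt z v) i - l * v i +
      if (i : ℕ) = 0 then z * c (Fin.ofNat k (k - 1)) * v (Fin.ofNat k (k - 1)) else 0 := by
  rw [Matrix.sub_mulVec, Pi.sub_apply, symbol_mulVec, Matrix.smul_mulVec, Matrix.one_mulVec,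
    Pi.smul_apply, smul_eq_mul]
  ring

/-- Rows of the tridiagonal matrix with index at least `k + 1` act as the rows `k` steps above. -/
theorem tridiagMulVec_add_period {k : ℕ} [NeZero k] (a b c : Fin k → ℂ) (x : ℕ → ℂ) (n : ℕ) :
    tridiagMulVec a b c x (n + k) = tridiagMulVec a b c (fun m => x (m + k)) n +
      if n = 0 then c (Fin.ofNat k (k - 1)) * x (k - 1) else 0 := by
  have hk : 0 < k := Nat.pos_of_neZero k
  cases n with
  | zero =>
    obtain ⟨j, rfl⟩ : ∃ j, k = j + 1 := ⟨k - 1, by omega⟩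
    have h := ofNat_add_self (k := j + 1) 0
    rw [zero_add] at h
    rw [zero_add, tridiagMulVec_succ, tridiagMulVec_zero, if_pos rfl, h, zero_add, add_comm 1]
    simp only [Nat.add_sub_cancel]
    ring
  | succ n =>
    rw [show n + 1 + k = n + k + 1 by omega, tridiagMulVec_succ, tridiagMulVec_succ,
      if_neg (by omega), show n + k + 1 = n + 1 + k by omega, show n + k + 2 = n + 2 + k by omega,
      ofNat_add_self, ofNat_add_self, add_zero]

/-- A Bloch wave solves the half-line equation up to a defect in row 0, where the left neighbour is
cut off. The defect disappears when the last entry of `v` is 0. -/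
theorem tridiagMulVec_quasiPeriodicExt {k : ℕ} [NeZero k] (a b c : Fin k → ℂ) {z l : ℂ}
    (hz : z ≠ 0) {v : Fin k → ℂ}
    (h : (symbol a b c z - l • (1 : Matrix (Fin k) (Fin k) ℂ)) *ᵥ v = 0) (n : ℕ) :
    tridiagMulVec a b c (quasiPeriodicExt z v) n = l * quasiPeriodicExt z v n -
      if n = 0 then z * c (Fin.ofNat k (k - 1)) * v (Fin.ofNat k (k - 1)) else 0 := by
  have hk : 0 < k := Nat.pos_of_neZero k
  induction n using Nat.strong_induction_on with
  | _ n ih =>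
    by_cases hn : n < k
    · have h1 := congrFun h ⟨n, hn⟩
      rw [symbol_sub_mulVec, Pi.zero_apply] at h1
      have h2 := quasiPeriodicExt_val z v ⟨n, hn⟩
      simp only at h1 h2
      rw [h2]
      linear_combination h1
    · obtain ⟨m, rfl⟩ : ∃ m, n = m + k := ⟨n - k, by omega⟩
      have hl := quasiPeriodicExt_val z v (Fin.ofNat k (k - 1))
      have hv : ((Fin.ofNat k (k - 1) : Fin k) : ℕ) = k - 1 := by
        simp [Nat.mod_eq_of_lt (show k - 1 < k by omega)]
      rw [hv] at hl
      simp only [tridiagMulVec_add_period, quasiPeriodicExt_add, tridiagMulVec_smul]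
      rw [ih m (by omega), if_neg (show ¬ m + k = 0 by omega), hl]
      split_ifs
      · field_simp
        ring
      · ring

/-! ### The kernel of `T - l` and shifts by a period -/

theorem mem_ker_iff {k : ℕ} [NeZero k] (a b c : Fin k → ℂ) (l : ℂ) (w : EllTwo) :
    w ∈ (toeplitzOp a b c - l • ContinuousLinearMap.id ℂ EllTwo).ker ↔
      ∀ n, tridiagMulVec a b c w n = l * w n := by
  rw [LinearMap.mem_ker]
  constructor
  · intro h n
    have := congrArg (fun x : EllTwo => x n) h
    exact sub_eq_zero.1 this
  · intro h
    apply lp.ext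
    funext n
    exact sub_eq_zero.2 (h n)

theorem apply_eq_smul_iff {k : ℕ} [NeZero k] (a b c : Fin k → ℂ) (l : ℂ) (w : EllTwo) :
    toeplitzOp a b c w = l • w ↔ ∀ n, tridiagMulVec a b c w n = l * w n := by
  rw [← mem_ker_iff, LinearMap.mem_ker, ← sub_eq_zero]
  rfl

theorem memℓp_two_iff {x : ℕ → ℂ} : Memℓp x 2 ↔ Summable fun n => ‖x n‖ ^ 2 := by
  rw [memℓp_gen_iff (by norm_num)]
  simp

theorem memℓp_leftShift (k : ℕ) (w : EllTwo) : Memℓp (fun n => w (n + k) : ℕ → ℂ) 2 := by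
  rw [memℓp_two_iff]
  exact (summable_nat_add_iff k).2 (memℓp_two_iff.1 (lp.memℓp w))

theorem memℓp_rightShift (k : ℕ) (w : EllTwo) :
    Memℓp (fun n => if n < k then 0 else w (n - k) : ℕ → ℂ) 2 := by
  rw [memℓp_two_iff, ← summable_nat_add_iff k]
  simpa using memℓp_two_iff.1 (lp.memℓp w)

/-- The shift of a square-summable sequence by `k` places to the right. -/
def rightShift (k : ℕ) : EllTwo →ₗ[ℂ] EllTwo where
  toFun w := ⟨fun n => if n < k then 0 else w (n - k), memℓp_rightShift k w⟩
  map_add' x y := by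
    apply lp.ext
    funext n
    change (if n < k then (0 : ℂ) else x (n - k) + y (n - k)) =
      (if n < k then 0 else x (n - k)) + (if n < k then 0 else y (n - k))
    split_ifs <;> simp
  map_smul' r x := by
    apply lp.ext
    funext n
    change (if n < k then (0 : ℂ) else r * x (n - k)) = r * (if n < k then 0 else x (n - k))
    split_ifs <;> simp

theorem rightShift_apply (k : ℕ) (w : EllTwo) (n : ℕ) :
    rightShift k w n = if n < k then 0 else w (n - k) := rfl

/-- Prepending a zero block creates only one new coupling, `b_{k-1} w_0` in row `k - 1`, and `h0`
removes it. -/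
theorem tridiagMulVec_rightShift {k : ℕ} [NeZero k] (a b c : Fin k → ℂ) {l : ℂ} {w : EllTwo}
    (hw : ∀ n, tridiagMulVec a b c w n = l * w n) (h0 : b (Fin.ofNat k (k - 1)) * w 0 = 0) (n : ℕ) :
    tridiagMulVec a b c (rightShift k w) n = l * rightShift k w n := by
  have hk : 0 < k := Nat.pos_of_neZero k
  rcases lt_or_ge n k with hn | hn
  · rw [rightShift_apply, if_pos hn, mul_zero]
    cases n with
    | zero =>
      rw [tridiagMulVec_zero, rightShift_apply, rightShift_apply, if_pos hn]
      split_ifs with h1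
      · simp
      · obtain rfl : k = 1 := by omega
        simpa using h0
    | succ n =>
      rw [tridiagMulVec_succ, rightShift_apply, rightShift_apply, rightShift_apply, if_pos hn,
        if_pos (by omega)]
      split_ifs with h1
      · simp
      · obtain rfl : k = n + 2 := by omega
        simpa using h0
  · obtain ⟨m, rfl⟩ : ∃ m, n = m + k := ⟨n - k, by omega⟩
    rw [tridiagMulVec_add_period]
    have : (fun m => rightShift k w (m + k)) = w := by
      funext j
      simp [rightShift_apply]
    rw [this, hw, rightShift_apply, rightShift_apply, if_pos (by omega : k - 1 < k)]
    simp

/-- If the kernel of `T - l` is finite-dimensional, a nonzero kernel element has `b_k w_1 ≠ 0`: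
otherwise its shifts to the right would all lie in the kernel. -/
theorem eq_zero_of_mem_ker {k : ℕ} [NeZero k] (a b c : Fin k → ℂ) {l : ℂ}
    (hfin : FiniteDimensional ℂ (toeplitzOp a b c - l • ContinuousLinearMap.id ℂ EllTwo).ker)
    {w : EllTwo} (hw : ∀ n, tridiagMulVec a b c w n = l * w n)
    (h0 : b (Fin.ofNat k (k - 1)) * w 0 = 0) : w = 0 := by
  have hk : 0 < k := Nat.pos_of_neZero k
  let K : Submodule ℂ EllTwo := (toeplitzOp a b c - l • ContinuousLinearMap.id ℂ EllTwo).ker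
  let K' : Submodule ℂ EllTwo :=
    { carrier := {w | w ∈ K ∧ b (Fin.ofNat k (k - 1)) * w 0 = 0}
      add_mem' := by
        rintro x y ⟨hx, hx0⟩ ⟨hy, hy0⟩
        refine ⟨K.add_mem hx hy, ?_⟩
        change _ * (x 0 + y 0) = 0
        rw [mul_add, hx0, hy0, add_zero]
      zero_mem' := ⟨K.zero_mem, mul_zero _⟩
      smul_mem' := by
        rintro r x ⟨hx, hx0⟩
        refine ⟨K.smul_mem r hx, ?_⟩
        change _ * (r * x 0) = 0
        rw [mul_left_comm, hx0, mul_zero] }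
  have hK' : K' ≤ K := fun x hx => hx.1
  have : FiniteDimensional ℂ K := hfin
  have : FiniteDimensional ℂ K' := Submodule.finiteDimensional_of_le hK'
  have hmaps : ∀ x ∈ K', rightShift k x ∈ K' := fun x hx =>
    ⟨(mem_ker_iff a b c l _).2
      (tridiagMulVec_rightShift a b c ((mem_ker_iff a b c l _).1 hx.1) hx.2),
      by rw [rightShift_apply, if_pos hk, mul_zero]⟩
  let S : K' →ₗ[ℂ] K' := (rightShift k).restrict hmaps
  have hinj : Function.Injective S := by
    rw [← LinearMap.ker_eq_bot, LinearMap.ker_eq_bot']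
    intro x hx
    apply Subtype.ext
    apply lp.ext
    funext n
    have h := congrArg (fun y : K' => (y : EllTwo) (n + k)) hx
    change rightShift k x (n + k) = 0 at h
    rw [rightShift_apply, if_neg (by omega), Nat.add_sub_cancel] at h
    exact h
  have hsurj := LinearMap.surjective_of_injective hinj
  -- The shift is injective, hence surjective, on the finite-dimensional `K'`. So each element is an
  -- `m`-fold shift for every `m`, and starts with arbitrarily many zeros.
  have key : ∀ m : ℕ, ∀ x : K', ∀ n < m * k, (x : EllTwo) n = 0 := by
    intro m
    induction m with
    | zero => simp
    | succ m ih =>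
      intro x n hn
      obtain ⟨y, rfl⟩ := hsurj x
      change rightShift k y n = 0
      rw [rightShift_apply]
      split_ifs with h
      · rfl
      · apply ih
        rw [add_mul] at hn
        omega
  apply lp.ext
  funext n
  refine key (n + 1) ⟨w, (mem_ker_iff a b c l w).2 hw, h0⟩ n ?_
  nlinarith

theorem tendsto_apply_zero (w : EllTwo) :
    Filter.Tendsto (fun n => w n) Filter.atTop (nhds 0) := by
  have h := (memℓp_two_iff.1 (lp.memℓp w)).tendsto_atTop_zero
  rw [tendsto_zero_iff_norm_tendsto_zero]
  have h2 := h.sqrt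
  simpa [Real.sqrt_sq] using h2

/-! ### The Wronskian and the eigenvector of the leading block -/

/-- The Wronskian of a solution and its shift by one period is constant. -/
theorem wronskian_eq {k : ℕ} [NeZero k] (a b : Fin k → ℂ) {l : ℂ} {w : ℕ → ℂ}
    (hw : ∀ n, tridiagMulVec a b b w n = l * w n) (n : ℕ) :
    b (Fin.ofNat k n) * (w n * w (n + 1 + k) - w (n + 1) * w (n + k)) =
      -(b (Fin.ofNat k (k - 1)) * w 0 * w (k - 1)) := by
  induction n with
  | zero =>
    have h0 := hw 0
    have hk := hw (0 + k)
    -- Row `k` has a left neighbour and row 0 has none; this mismatch is the constant on the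
    -- right-hand side.
    rw [tridiagMulVec_add_period, if_pos rfl, tridiagMulVec_zero] at hk
    rw [tridiagMulVec_zero] at h0
    linear_combination w 0 * hk - w (0 + k) * h0
  | succ n ih =>
    have h0 := hw (n + 1)
    have hk := hw (n + 1 + k)
    rw [tridiagMulVec_add_period, if_neg (by omega), tridiagMulVec_succ] at hk
    rw [tridiagMulVec_succ] at h0
    rw [← ih]
    linear_combination w (n + 1) * hk - w (n + 1 + k) * h0

/-- The constant Wronskian tends to 0, because `w n` does and `b` is bounded. -/
theorem mul_apply_pred_eq_zero {k : ℕ} [NeZero k] (a b : Fin k → ℂ) {l : ℂ} {w : EllTwo}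
    (hw : ∀ n, tridiagMulVec a b b w n = l * w n) :
    b (Fin.ofNat k (k - 1)) * w 0 * w (k - 1) = 0 := by
  have h0 := tendsto_apply_zero w
  have hs : ∀ j, Filter.Tendsto (fun n => w (n + j)) Filter.atTop (nhds 0) := fun j =>
    h0.comp (Filter.tendsto_add_atTop_nat j)
  have h1 : Filter.Tendsto (fun n => w n * w (n + 1 + k) - w (n + 1) * w (n + k)) Filter.atTop
      (nhds 0) := by
    have := (h0.mul (hs (1 + k))).sub ((hs 1).mul (hs k))
    simpa [add_assoc] using this
  have h2 : Filter.Tendsto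
      (fun n => b (Fin.ofNat k n) * (w n * w (n + 1 + k) - w (n + 1) * w (n + k))) Filter.atTop
      (nhds 0) := by
    rw [tendsto_zero_iff_norm_tendsto_zero] at h1 ⊢
    have h3 := h1.const_mul (∑ i, ‖b i‖)
    rw [mul_zero] at h3
    refine squeeze_zero (fun _ => norm_nonneg _) (fun n => ?_) h3
    rw [norm_mul]
    gcongr
    exact Finset.single_le_sum (f := fun i => ‖b i‖) (fun i _ => norm_nonneg _) (Finset.mem_univ _)
  simp only [wronskian_eq a b hw] at h2
  exact neg_eq_zero.1 (tendsto_nhds_unique tendsto_const_nhds h2)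

theorem Matrix.mem_spectrum_iff_exists_mulVec {n : Type*} [Fintype n] [DecidableEq n]
    (M : Matrix n n ℂ) (l : ℂ) : l ∈ spectrum ℂ M ↔ ∃ v, v ≠ 0 ∧ M *ᵥ v = l • v := by
  rw [spectrum.mem_iff, Matrix.isUnit_iff_isUnit_det, isUnit_iff_ne_zero, not_not,
    ← Matrix.exists_mulVec_eq_zero_iff]
  refine exists_congr fun v => and_congr_right fun _ => ?_
  rw [Matrix.sub_mulVec, sub_eq_zero, Matrix.algebraMap_eq_diagonal, eq_comm]
  congr! 1
  ext i
  simp [Matrix.mulVec_diagonal]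

theorem leadingBlock_mulVec {k : ℕ} [NeZero k] (a b c : Fin k → ℂ) {x : ℕ → ℂ}
    (hx : x (k - 1) = 0) (i : Fin (k - 1)) :
    (leadingBlock a b c *ᵥ fun j => x j) i = tridiagMulVec a b c x i := by
  have hi := i.isLt
  rw [tridiagMulVec_eq_sum a b c x (show (i : ℕ) + 2 ≤ k - 1 + 1 by omega),
    Finset.sum_range_succ, hx, mul_zero, add_zero, Finset.sum_range]
  rfl

theorem apply_pred_eq_zero {k : ℕ} [NeZero k] (a b : Fin k → ℂ) {l : ℂ}
    (hfin : FiniteDimensional ℂ (toeplitzOp a b b - l • ContinuousLinearMap.id ℂ EllTwo).ker)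
    {w : EllTwo} (hw : ∀ n, tridiagMulVec a b b w n = l * w n) : w (k - 1) = 0 := by
  rcases mul_eq_zero.1 (mul_apply_pred_eq_zero a b hw) with h | h
  · rw [eq_zero_of_mem_ker a b b hfin hw h]
    rfl
  · exact h

theorem mem_spectrum_leadingBlock {k : ℕ} [NeZero k] (a b : Fin k → ℂ) {l : ℂ}
    (hfin : FiniteDimensional ℂ (toeplitzOp a b b - l • ContinuousLinearMap.id ℂ EllTwo).ker)
    {w : EllTwo} (hw : ∀ n, tridiagMulVec a b b w n = l * w n) (hne : w ≠ 0) :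
    l ∈ spectrum ℂ (leadingBlock a b b) := by
  have hpred := apply_pred_eq_zero a b hfin hw
  have h0 : w 0 ≠ 0 := fun h => hne (eq_zero_of_mem_ker a b b hfin hw (by rw [h, mul_zero]))
  -- For `k = 1` the entries 0 and `k - 1` coincide, so there is no nonzero kernel element.
  have hk : 0 < k - 1 := by
    rcases Nat.eq_zero_or_pos (k - 1) with h | h
    · rw [h] at hpred
      exact absurd hpred h0
    · exact h
  rw [Matrix.mem_spectrum_iff_exists_mulVec]
  refine ⟨fun j => w j, fun h => h0 (congrFun h ⟨0, hk⟩), ?_⟩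
  funext i
  rw [leadingBlock_mulVec a b b hpred, hw]
  rfl

/-! ### Exponential decay of kernel elements -/

/-- A sequence that is multiplied by a factor of modulus less than one over each period decays
exponentially. -/
theorem exists_exp_bound {k : ℕ} (hk : 0 < k) {w : ℕ → ℂ} {r : ℂ} (hr : ‖r‖ < 1)
    (hw : ∀ n, w (n + k) = r * w n) :
    ∃ C ρ : ℝ, 0 < ρ ∧ ρ < 1 ∧ ∀ n : ℕ, ‖w n‖ ≤ C * ρ ^ n := by
  -- Passing from `‖r‖` to a larger `s` keeps the rate `ρ` positive even if `r = 0`.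
  obtain ⟨s, hs1, hs2⟩ := exists_between hr
  have hs0 : 0 < s := (norm_nonneg _).trans_lt hs1
  set ρ : ℝ := s ^ (k : ℝ)⁻¹ with hρ
  have hρk : ρ ^ k = s := Real.rpow_inv_natCast_pow hs0.le hk.ne'
  have hρ0 : 0 < ρ := Real.rpow_pos_of_pos hs0 _
  have hρ1 : ρ < 1 := Real.rpow_lt_one hs0.le hs2 (by positivity)
  refine ⟨(∑ i ∈ Finset.range k, ‖w i‖) * (ρ ^ k)⁻¹, ρ, hρ0, hρ1, fun n => ?_⟩
  induction n using Nat.strong_induction_on with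
  | _ n ih =>
    by_cases hn : n < k
    · have h1 : ‖w n‖ ≤ ∑ i ∈ Finset.range k, ‖w i‖ :=
        Finset.single_le_sum (f := fun i => ‖w i‖) (fun _ _ => norm_nonneg _)
          (Finset.mem_range.2 hn)
      have h2 : 1 ≤ (ρ ^ k)⁻¹ * ρ ^ n := by
        rw [inv_mul_eq_div, one_le_div (by positivity)]
        exact pow_le_pow_of_le_one hρ0.le hρ1.le hn.le
      calc ‖w n‖ ≤ (∑ i ∈ Finset.range k, ‖w i‖) * 1 := by rwa [mul_one]
        _ ≤ (∑ i ∈ Finset.range k, ‖w i‖) * ((ρ ^ k)⁻¹ * ρ ^ n) := by gcongr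
        _ = _ := by ring
    · obtain ⟨m, rfl⟩ : ∃ m, n = m + k := ⟨n - k, by omega⟩
      have h1 := ih m (by omega)
      rw [hw, norm_mul]
      calc ‖r‖ * ‖w m‖ ≤ s * ((∑ i ∈ Finset.range k, ‖w i‖) * (ρ ^ k)⁻¹ * ρ ^ m) := by gcongr
        _ = _ := by rw [← hρk]; ring

theorem memℓp_of_exp_bound {w : ℕ → ℂ} {C ρ : ℝ} (h0 : 0 < ρ) (h1 : ρ < 1)
    (hw : ∀ n : ℕ, ‖w n‖ ≤ C * ρ ^ n) : Memℓp w 2 := by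
  rw [memℓp_two_iff]
  have hρ : ρ ^ 2 < 1 := by nlinarith
  refine Summable.of_nonneg_of_le (fun _ => by positivity) (fun n => ?_)
    ((summable_geometric_of_lt_one (by positivity) hρ).mul_left (C ^ 2))
  calc ‖w n‖ ^ 2 ≤ (C * ρ ^ n) ^ 2 := pow_le_pow_left₀ (norm_nonneg _) (hw n) 2
    _ = _ := by ring

/-- Kernel elements of `T - l` decay exponentially if the kernel is finite-dimensional. -/
theorem exists_exp_bound_of_mem_ker {k : ℕ} [NeZero k] (a b : Fin k → ℂ) {l : ℂ}
    (hfin : FiniteDimensional ℂ (toeplitzOp a b b - l • ContinuousLinearMap.id ℂ EllTwo).ker)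
    {w : EllTwo} (hw : ∀ n, tridiagMulVec a b b w n = l * w n) (hne : w ≠ 0) :
    ∃ C ρ : ℝ, 0 < ρ ∧ ρ < 1 ∧ ∀ n : ℕ, ‖w n‖ ≤ C * ρ ^ n := by
  have hk : 0 < k := Nat.pos_of_neZero k
  have hpred := apply_pred_eq_zero a b hfin hw
  have h0 : w 0 ≠ 0 := fun h => hne (eq_zero_of_mem_ker a b b hfin hw (by rw [h, mul_zero]))
  set r : ℂ := w k / w 0 with hr
  -- The factor `r` is chosen so that `u 0 = 0`. As `w (k - 1) = 0`, the left shift is again a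
  -- solution, so `u` is a kernel element vanishing at 0.
  let u : EllTwo := ⟨fun n => w (n + k), memℓp_leftShift k w⟩ + (-r) • w
  have hu : ∀ n, u n = w (n + k) + -r * w n := fun n => rfl
  have hu0 : u = 0 := by
    refine eq_zero_of_mem_ker a b b hfin (l := l) (fun n => ?_) ?_
    · have h := hw (n + k)
      rw [tridiagMulVec_add_period, hpred, mul_zero, ite_self, add_zero] at h
      have hfun : (u : ℕ → ℂ) = fun n => w (n + k) + -r * w n := funext hu
      rw [hfun, tridiagMulVec_add, h, tridiagMulVec_smul, hw]
      ring
    · rw [hu, hr, zero_add]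
      field_simp
      ring
  have hper : ∀ n, w (n + k) = r * w n := fun n => by
    have h := hu n
    rw [hu0] at h
    change 0 = _ at h
    linear_combination -h
  refine exists_exp_bound hk ?_ hper
  have hpow : ∀ m : ℕ, w (m * k) = r ^ m * w 0 := by
    intro m
    induction m with
    | zero => simp
    | succ m ih => rw [add_mul, one_mul, hper, ih]; ring
  by_contra! hge
  have ht : Filter.Tendsto (fun m : ℕ => ‖w (m * k)‖) Filter.atTop (nhds 0) := by
    have := (tendsto_apply_zero w).comp (Filter.tendsto_id.atTop_mul_const' hk)
    simpa using this.norm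
  have hle : ‖w 0‖ ≤ 0 := by
    refine ge_of_tendsto ht (Filter.Eventually.of_forall fun m => ?_)
    rw [hpow, norm_mul, norm_pow]
    exact le_mul_of_one_le_left (norm_nonneg _) (one_le_pow₀ hge)
  exact h0 (norm_le_zero_iff.1 hle)

/-! ### Discrete Fourier transform over blocks and the estimate off `sigmaDet` -/

/-- Parseval's identity for the discrete Fourier transform. -/
theorem IsPrimitiveRoot.sum_norm_sq_dft {N : ℕ} {ζ : ℂ} (hζ : IsPrimitiveRoot ζ N) (hN : N ≠ 0)
    (u : ℕ → ℂ) :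
    ∑ r ∈ Finset.range N, ‖∑ m ∈ Finset.range N, (ζ ^ r) ^ m * u m‖ ^ 2 =
      N * ∑ m ∈ Finset.range N, ‖u m‖ ^ 2 := by
  have hnorm : ‖ζ‖ = 1 := hζ.norm'_eq_one hN
  have hz0 : ζ ≠ 0 := hζ.ne_zero hN
  have hconj : (starRingEnd ℂ) ζ = ζ⁻¹ := (Complex.inv_eq_conj hnorm).symm
  have horth : ∀ m ∈ Finset.range N, ∀ n ∈ Finset.range N,
      ∑ r ∈ Finset.range N, (ζ ^ m * (ζ⁻¹) ^ n) ^ r = if m = n then (N : ℂ) else 0 := by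
    intro m hm n hn
    split_ifs with h
    · subst h
      have : ζ ^ m * ζ⁻¹ ^ m = 1 := by rw [← mul_pow, mul_inv_cancel₀ hz0, one_pow]
      simp only [this, one_pow, Finset.sum_const, Finset.card_range, nsmul_eq_mul, mul_one]
    · have hq : ζ ^ m * ζ⁻¹ ^ n ≠ 1 := by
        intro hq
        rw [inv_pow, mul_inv_eq_one₀ (pow_ne_zero _ hz0)] at hq
        exact h (hζ.pow_inj (Finset.mem_range.1 hm) (Finset.mem_range.1 hn) hq)
      have hqN : (ζ ^ m * ζ⁻¹ ^ n) ^ N = 1 := by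
        rw [mul_pow, ← pow_mul, ← pow_mul, mul_comm m, mul_comm n, pow_mul, pow_mul, inv_pow,
          hζ.pow_eq_one]
        simp
      rw [geom_sum_eq hq, hqN, sub_self, zero_div]
  have key : ∑ r ∈ Finset.range N, (∑ m ∈ Finset.range N, (ζ ^ r) ^ m * u m) *
      (starRingEnd ℂ) (∑ m ∈ Finset.range N, (ζ ^ r) ^ m * u m) =
      N * ∑ m ∈ Finset.range N, u m * (starRingEnd ℂ) (u m) := by
    calc _ = ∑ r ∈ Finset.range N, ∑ m ∈ Finset.range N, ∑ n ∈ Finset.range N,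
          (u m * (starRingEnd ℂ) (u n)) * (ζ ^ m * (ζ⁻¹) ^ n) ^ r := by
          refine Finset.sum_congr rfl fun r _ => ?_
          rw [map_sum, Finset.sum_mul_sum]
          refine Finset.sum_congr rfl fun m _ => Finset.sum_congr rfl fun n _ => ?_
          rw [map_mul, map_pow, map_pow, hconj]
          ring
      _ = ∑ m ∈ Finset.range N, ∑ n ∈ Finset.range N,
          (u m * (starRingEnd ℂ) (u n)) * if m = n then (N : ℂ) else 0 := by
          rw [Finset.sum_comm]
          refine Finset.sum_congr rfl fun m hm => ?_
          rw [Finset.sum_comm]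
          refine Finset.sum_congr rfl fun n hn => ?_
          rw [← Finset.mul_sum, horth m hm n hn]
      _ = _ := by
          rw [Finset.mul_sum]
          refine Finset.sum_congr rfl fun m hm => ?_
          simp only [mul_ite, mul_zero]
          rw [Finset.sum_ite_eq, if_pos hm]
          ring
  simp only [Complex.mul_conj'] at key
  exact_mod_cast key

/-- The generating function of a sequence along the residue class of `j`. -/
def blockTransform (k N : ℕ) (z : ℂ) (x : ℕ → ℂ) (j : ℕ) : ℂ :=
  ∑ m ∈ Finset.range N, z ^ m * x (m * k + j)

/-- Moving by one period only drops the term `m = 0`. The spare block in `M + 1`, beyond the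
support, ensures that nothing is lost at the far end. -/
theorem mul_blockTransform_add {k M : ℕ} (z : ℂ) {x : ℕ → ℂ}
    (hx : ∀ n, M * k ≤ n → x n = 0) (j : ℕ) :
    z * blockTransform k (M + 1) z x (j + k) = blockTransform k (M + 1) z x j - x j := by
  have h : blockTransform k (M + 1) z x j = ∑ m ∈ Finset.range (M + 2), z ^ m * x (m * k + j) := by
    rw [Finset.sum_range_succ _ (M + 1), hx _ (by nlinarith), mul_zero, add_zero]
    rfl
  rw [h, Finset.sum_range_succ', blockTransform, Finset.mul_sum]
  simp only [zero_mul, zero_add, pow_zero, one_mul, add_sub_cancel_right]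
  refine Finset.sum_congr rfl fun m _ => ?_
  rw [show m * k + (j + k) = (m + 1) * k + j by ring]
  ring

theorem tridiagMulVec_mul {k : ℕ} [NeZero k] (a b c : Fin k → ℂ) (x : ℕ → ℂ) (m : ℕ) :
    tridiagMulVec a b c x (m * k) = a (Fin.ofNat k 0) * x (m * k) +
      b (Fin.ofNat k 0) * x (m * k + 1) +
      if m = 0 then 0 else c (Fin.ofNat k (k - 1)) * x (m * k - 1) := by
  have hk : 0 < k := Nat.pos_of_neZero k
  cases m with
  | zero => simp [tridiagMulVec_zero]
  | succ m =>
    have h := ofNat_mul_add (k := k) (m + 1) 0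
    rw [add_zero] at h
    have e : (m + 1) * k = m * k + (k - 1) + 1 := by rw [add_mul]; omega
    rw [if_neg (by omega), e, tridiagMulVec_succ, ← e, h, ofNat_mul_add, show (m + 1) * k - 1 = m * k + (k - 1) by omega,
      show m * k + (k - 1) + 2 = (m + 1) * k + 1 by omega]
    ring

theorem blockTransform_tridiagMulVec {k M : ℕ} [NeZero k] (a b c : Fin k → ℂ) (z : ℂ) {x : ℕ → ℂ}
    (hx : ∀ n, M * k ≤ n → x n = 0) (i : ℕ) :
    blockTransform k (M + 1) z (tridiagMulVec a b c x) i =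
      tridiagMulVec a b c (blockTransform k (M + 1) z x) i +
      if i = 0 then z * c (Fin.ofNat k (k - 1)) * blockTransform k (M + 1) z x (k - 1) else 0 := by
  have hk : 0 < k := Nat.pos_of_neZero k
  cases i with
  | succ i =>
    rw [if_neg (by omega), add_zero, tridiagMulVec_succ]
    simp only [blockTransform, Finset.mul_sum, ← Finset.sum_add_distrib]
    refine Finset.sum_congr rfl fun m _ => ?_
    rw [← add_assoc, tridiagMulVec_succ, add_assoc (m * k) i 1, ofNat_mul_add, ofNat_mul_add,
      add_assoc (m * k) i 2]
    ring
  | zero =>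
    rw [if_pos rfl, tridiagMulVec_zero]
    have h1 : z * c (Fin.ofNat k (k - 1)) * blockTransform k (M + 1) z x (k - 1) =
        ∑ m ∈ Finset.range (M + 1),
          z ^ m * if m = 0 then 0 else c (Fin.ofNat k (k - 1)) * x (m * k - 1) := by
      rw [Finset.sum_range_succ', blockTransform, Finset.sum_range_succ, hx _ (by omega), mul_zero,
        add_zero, Finset.mul_sum, if_pos rfl, mul_zero, add_zero]
      refine Finset.sum_congr rfl fun m _ => ?_
      rw [if_neg (by omega), show (m + 1) * k - 1 = m * k + (k - 1) by rw [add_mul]; omega]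
      ring
    rw [h1]
    simp only [blockTransform, Finset.mul_sum, ← Finset.sum_add_distrib, add_zero]
    refine Finset.sum_congr rfl fun m _ => ?_
    rw [tridiagMulVec_mul]
    ring

theorem norm_apply_le_sum {k : ℕ} (b : Fin k → ℂ) (i : Fin k) : ‖b i‖ ≤ ∑ j, ‖b j‖ :=
  Finset.single_le_sum (f := fun i => ‖b i‖) (fun _ _ => norm_nonneg _) (Finset.mem_univ _)

/-- The symbol reads the transform through its quasi-periodic extension. That extension and the
transform agree at indices below `k` and differ by `z⁻¹ x 0` at `k`, which only the last row sees.
-/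
theorem norm_symbol_mulVec_blockTransform_le {k M : ℕ} [NeZero k] (a b c : Fin k → ℂ) (l : ℂ)
    {z : ℂ} (hz : ‖z‖ = 1) {x : ℕ → ℂ} (hx : ∀ n, M * k ≤ n → x n = 0) (i : Fin k) :
    ‖((symbol a b c z - l • (1 : Matrix (Fin k) (Fin k) ℂ)) *ᵥ
        fun j : Fin k => blockTransform k (M + 1) z x j) i‖ ≤
      ‖blockTransform k (M + 1) z (fun n => tridiagMulVec a b c x n - l * x n) i‖ +
        (∑ j, ‖b j‖) * ‖x 0‖ := by
  have hk : 0 < k := Nat.pos_of_neZero k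
  have hz0 : z ≠ 0 := by rintro rfl; simp at hz
  set F := blockTransform k (M + 1) z x with hF
  set q := quasiPeriodicExt z (fun j : Fin k => F j) with hq
  have hqF : ∀ j, j < k → q j = F j := fun j hj => quasiPeriodicExt_val z _ ⟨j, hj⟩
  have hqk : q k - F k = z⁻¹ * x 0 := by
    have h1 := quasiPeriodicExt_add z (fun j : Fin k => F j) 0
    have h2 := mul_blockTransform_add z hx 0
    rw [zero_add, ← hq, hqF 0 hk] at h1
    rw [zero_add, ← hF] at h2
    rw [h1]
    field_simp
    linear_combination -h2
  have hy : blockTransform k (M + 1) z (fun n => tridiagMulVec a b c x n - l * x n) i =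
      blockTransform k (M + 1) z (tridiagMulVec a b c x) i - l * F i := by
    rw [hF]
    simp only [blockTransform, Finset.mul_sum, ← Finset.sum_sub_distrib]
    exact Finset.sum_congr rfl fun m _ => by ring
  have hlast : ((Fin.ofNat k (k - 1) : Fin k) : ℕ) = k - 1 := by
    simp [Nat.mod_eq_of_lt (show k - 1 < k by omega)]
  have hT : ‖tridiagMulVec a b c q i - tridiagMulVec a b c F i‖ ≤ (∑ j, ‖b j‖) * ‖x 0‖ := by
    have hi := i.isLt
    have hdiff : tridiagMulVec a b c q i - tridiagMulVec a b c F i =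
        b (Fin.ofNat k i) * (q (i + 1) - F (i + 1)) := by
      rcases hi0 : (i : ℕ) with _ | n
      · rw [tridiagMulVec_zero, tridiagMulVec_zero, hqF 0 hk]
        ring
      · rw [tridiagMulVec_succ, tridiagMulVec_succ, hqF n (by omega), hqF (n + 1) (by omega)]
        ring
    rw [hdiff, norm_mul]
    rcases Nat.lt_or_ge (i + 1) k with h | h
    · rw [hqF _ h, sub_self, norm_zero, mul_zero]
      positivity
    · rw [show (i : ℕ) + 1 = k by omega, hqk, norm_mul, norm_inv, hz, inv_one, one_mul]
      gcongr
      exact norm_apply_le_sum b _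
  rw [symbol_sub_mulVec, hy, blockTransform_tridiagMulVec a b c z hx, ← hF, ← hq, hlast]
  refine le_trans (le_of_eq ?_) ((norm_add_le _ _).trans (add_le_add_right hT _))
  congr 1
  ring

/-- The inverse, written as adjugate over determinant, is continuous on the compact unit circle, so
its entries are bounded. -/
theorem exists_norm_le_of_det_ne_zero {k : ℕ} [NeZero k] (a b c : Fin k → ℂ) {l : ℂ}
    (hl : l ∉ sigmaDet a b c) : ∃ C : ℝ, 0 ≤ C ∧ ∀ z : ℂ, ‖z‖ = 1 → ∀ (v : Fin k → ℂ) (i : Fin k),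
      ‖v i‖ ≤ C * ∑ j, ‖((symbol a b c z - l • (1 : Matrix (Fin k) (Fin k) ℂ)) *ᵥ v) j‖ := by
  have hdet : ∀ z : ℂ, ‖z‖ = 1 →
      (symbol a b c z - l • (1 : Matrix (Fin k) (Fin k) ℂ)).det ≠ 0 :=
    fun z hz h => hl ⟨z, hz, h⟩
  set S : ℂ → Matrix (Fin k) (Fin k) ℂ := fun z =>
    symbol a b c z - l • (1 : Matrix (Fin k) (Fin k) ℂ) with hS
  have hcont : ContinuousOn S (Metric.sphere (0 : ℂ) 1) := by
    have hinv : ContinuousOn (fun z : ℂ => z⁻¹) (Metric.sphere (0 : ℂ) 1) :=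
      continuousOn_inv₀.mono fun z hz => by
        rintro rfl
        simp at hz
    exact (((hinv.smul continuousOn_const).add continuousOn_const).add
      (continuousOn_id.smul continuousOn_const)).sub continuousOn_const
  have hcinv : ContinuousOn (fun z => ∑ i, ∑ j, ‖((S z).det⁻¹ • (S z).adjugate) i j‖)
      (Metric.sphere (0 : ℂ) 1) := by
    have h1 : ContinuousOn (fun z => (S z).det⁻¹ • (S z).adjugate) (Metric.sphere (0 : ℂ) 1) :=
      ((continuous_id.matrix_det.comp_continuousOn hcont).inv₀ fun z hz =>
        hdet z (by simpa using hz)).smul (continuous_id.matrix_adjugate.comp_continuousOn hcont)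
    refine continuousOn_finsetSum _ fun i _ => continuousOn_finsetSum _ fun j _ => ?_
    exact ((continuous_id.matrix_elem i j).comp_continuousOn h1).norm
  obtain ⟨C, hC⟩ := (isCompact_sphere (0 : ℂ) 1).exists_bound_of_continuousOn hcinv
  refine ⟨|C|, abs_nonneg _, fun z hz v i => ?_⟩
  have hentry : ∀ j, ‖((S z).det⁻¹ • (S z).adjugate) i j‖ ≤ |C| := fun j => by
    refine le_trans ?_ ((Real.le_norm_self _).trans ((hC z (by simpa using hz)).trans (le_abs_self C)))
    refine le_trans ?_ (Finset.single_le_sum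
      (f := fun i => ∑ j, ‖((S z).det⁻¹ • (S z).adjugate) i j‖)
      (fun i _ => Finset.sum_nonneg fun _ _ => norm_nonneg _) (Finset.mem_univ i))
    exact Finset.single_le_sum
      (f := fun j => ‖((S z).det⁻¹ • (S z).adjugate) i j‖)
      (fun _ _ => norm_nonneg _) (Finset.mem_univ j)
  have hv : v = ((S z).det⁻¹ • (S z).adjugate) *ᵥ (S z *ᵥ v) := by
    rw [Matrix.mulVec_mulVec, Matrix.smul_mul, Matrix.adjugate_mul, smul_smul,
      inv_mul_cancel₀ (hdet z hz), one_smul, Matrix.one_mulVec]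
  calc ‖v i‖ = ‖(((S z).det⁻¹ • (S z).adjugate) *ᵥ (S z *ᵥ v)) i‖ := by rw [← hv]
    _ ≤ ∑ j, ‖((S z).det⁻¹ • (S z).adjugate) i j * (S z *ᵥ v) j‖ := by
        rw [Matrix.mulVec, dotProduct]
        exact norm_sum_le _ _
    _ ≤ ∑ j, |C| * ‖(S z *ᵥ v) j‖ := by
        refine Finset.sum_le_sum fun j _ => ?_
        rw [norm_mul]
        gcongr
        exact hentry j
    _ = _ := by rw [Finset.mul_sum]

theorem sum_range_mul_eq {k : ℕ} (N : ℕ) (g : ℕ → ℝ) :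
    ∑ n ∈ Finset.range (N * k), g n =
      ∑ i : Fin k, ∑ m ∈ Finset.range N, g (m * k + i) := by
  induction N with
  | zero => simp
  | succ N ih =>
    rw [add_mul, one_mul, Finset.sum_range_add, ih, Finset.sum_range (fun x => g (N * k + x)),
      ← Finset.sum_add_distrib]
    exact Finset.sum_congr rfl fun i _ => by rw [Finset.sum_range_succ]

theorem sum_norm_sq_blockTransform {k N : ℕ} {ζ : ℂ} (hζ : IsPrimitiveRoot ζ N) (hN : N ≠ 0)
    (x : ℕ → ℂ) :
    ∑ r ∈ Finset.range N, ∑ i : Fin k, ‖blockTransform k N (ζ ^ r) x i‖ ^ 2 =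
      N * ∑ n ∈ Finset.range (N * k), ‖x n‖ ^ 2 := by
  rw [sum_range_mul_eq, Finset.sum_comm, Finset.mul_sum]
  exact Finset.sum_congr rfl fun i _ => hζ.sum_norm_sq_dft hN fun m => x (m * k + i)

/-- The pointwise bound is summed over the `(M + 1)`-th roots of unity, and Parseval turns both
sides into sums over entries. The constant does not depend on `M`. -/
theorem exists_sum_norm_sq_le {k : ℕ} [NeZero k] (a b c : Fin k → ℂ) {l : ℂ}
    (hl : l ∉ sigmaDet a b c) : ∃ C : ℝ, 0 ≤ C ∧ ∀ (M : ℕ) (x : ℕ → ℂ),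
      (∀ n, M * k ≤ n → x n = 0) →
      ∑ n ∈ Finset.range ((M + 1) * k), ‖x n‖ ^ 2 ≤
        C * (∑ n ∈ Finset.range ((M + 1) * k), ‖tridiagMulVec a b c x n - l * x n‖ ^ 2 +
          ‖x 0‖ ^ 2) := by
  have hk : 0 < k := Nat.pos_of_neZero k
  obtain ⟨D, hD0, hD⟩ := exists_norm_le_of_det_ne_zero a b c hl
  set B := ∑ j, ‖b j‖ with hB
  have hB0 : 0 ≤ B := Finset.sum_nonneg fun _ _ => norm_nonneg _
  -- The outer `k` counts the rows summed, the inner `k` is from Cauchy–Schwarz, and 2 from the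
  -- square of a sum; `1 + k * B ^ 2` absorbs the coefficient of `‖x 0‖ ^ 2`.
  refine ⟨k * (D ^ 2 * k * 2) * (1 + k * B ^ 2), by positivity, fun M x hx => ?_⟩
  set y : ℕ → ℂ := fun n => tridiagMulVec a b c x n - l * x n with hy
  have hpt : ∀ z : ℂ, ‖z‖ = 1 → ∑ i : Fin k, ‖blockTransform k (M + 1) z x i‖ ^ 2 ≤
      k * (D ^ 2 * k * 2) *
        (∑ j : Fin k, ‖blockTransform k (M + 1) z y j‖ ^ 2 + k * B ^ 2 * ‖x 0‖ ^ 2) := by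
    intro z hz
    have h1 : ∀ i : Fin k, ‖blockTransform k (M + 1) z x i‖ ^ 2 ≤ D ^ 2 * k * 2 *
        (∑ j : Fin k, ‖blockTransform k (M + 1) z y j‖ ^ 2 + k * B ^ 2 * ‖x 0‖ ^ 2) := by
      intro i
      have h2 : ‖blockTransform k (M + 1) z x i‖ ≤
          D * ∑ j : Fin k, (‖blockTransform k (M + 1) z y j‖ + B * ‖x 0‖) := by
        refine (hD z hz (fun j : Fin k => blockTransform k (M + 1) z x j) i).trans ?_
        gcongr with j
        exact norm_symbol_mulVec_blockTransform_le a b c l hz hx j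
      calc ‖blockTransform k (M + 1) z x i‖ ^ 2
          ≤ (D * ∑ j : Fin k, (‖blockTransform k (M + 1) z y j‖ + B * ‖x 0‖)) ^ 2 := by gcongr
        _ = D ^ 2 * (∑ j : Fin k, (‖blockTransform k (M + 1) z y j‖ + B * ‖x 0‖)) ^ 2 := by ring
        _ ≤ D ^ 2 * (k * ∑ j : Fin k, (‖blockTransform k (M + 1) z y j‖ + B * ‖x 0‖) ^ 2) := by
            gcongr
            simpa using sq_sum_le_card_mul_sum_sq (s := (Finset.univ : Finset (Fin k)))
              (f := fun j : Fin k => ‖blockTransform k (M + 1) z y j‖ + B * ‖x 0‖)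
        _ ≤ D ^ 2 * (k * ∑ j : Fin k, (2 * (‖blockTransform k (M + 1) z y j‖ ^ 2 +
              (B * ‖x 0‖) ^ 2))) := by
            gcongr with j
            exact add_sq_le
        _ = _ := by
            rw [← Finset.mul_sum, Finset.sum_add_distrib]
            simp
            ring
    refine (Finset.sum_le_sum fun i _ => h1 i).trans (le_of_eq ?_)
    simp
    ring
  have hζ := Complex.isPrimitiveRoot_exp (M + 1) (Nat.succ_ne_zero M)
  set ζ := Complex.exp (2 * Real.pi * Complex.I / ((M + 1 : ℕ) : ℂ)) with hζdef
  have hnorm : ∀ r : ℕ, ‖ζ ^ r‖ = 1 := fun r => by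
    rw [norm_pow, hζ.norm'_eq_one (Nat.succ_ne_zero M), one_pow]
  have hsum := Finset.sum_le_sum fun r (_ : r ∈ Finset.range (M + 1)) => hpt (ζ ^ r) (hnorm r)
  rw [sum_norm_sq_blockTransform hζ (Nat.succ_ne_zero M), ← Finset.mul_sum,
    Finset.sum_add_distrib, sum_norm_sq_blockTransform hζ (Nat.succ_ne_zero M), Finset.sum_const,
    Finset.card_range, nsmul_eq_mul] at hsum
  set X := ∑ n ∈ Finset.range ((M + 1) * k), ‖x n‖ ^ 2
  set Y := ∑ n ∈ Finset.range ((M + 1) * k), ‖y n‖ ^ 2 with hY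
  have hY0 : 0 ≤ Y := Finset.sum_nonneg fun _ _ => by positivity
  have hM : (0 : ℝ) < ((M + 1 : ℕ) : ℝ) := by positivity
  have h3 : X ≤ k * (D ^ 2 * k * 2) * (Y + k * B ^ 2 * ‖x 0‖ ^ 2) := by
    refine le_of_mul_le_mul_left (hsum.trans (le_of_eq ?_)) hM
    ring
  refine h3.trans ?_
  rw [mul_assoc _ (1 + (k : ℝ) * B ^ 2)]
  gcongr
  have h4 : 0 ≤ (k : ℝ) * B ^ 2 * Y := by positivity
  have h5 : 0 ≤ ‖x 0‖ ^ 2 := by positivity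
  linarith

/-! ### The estimate on `ℓ²`, Fredholmness and invertibility -/

theorem EllTwo.norm_sq_eq_tsum (x : EllTwo) : ‖x‖ ^ 2 = ∑' n, ‖x n‖ ^ 2 := by
  simpa using lp.norm_rpow_eq_tsum (p := 2) (by norm_num) x

theorem EllTwo.sum_norm_sq_le (x : EllTwo) (s : Finset ℕ) : ∑ n ∈ s, ‖x n‖ ^ 2 ≤ ‖x‖ ^ 2 := by
  simpa using lp.sum_rpow_le_norm_rpow (p := 2) (by norm_num) x s

/-- The `n`-th coordinate as a continuous linear functional. -/
noncomputable def coordCLM (n : ℕ) : EllTwo →L[ℂ] ℂ :=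
  innerSL ℂ (lp.single 2 n (1 : ℂ) : EllTwo)

theorem coordCLM_apply (n : ℕ) (x : EllTwo) : coordCLM n x = x n := by
  rw [coordCLM, innerSL_apply_apply, lp.inner_single_left]
  simp

/-- Off the symbol spectrum, `T - l` is bounded below up to the first coordinate. -/
theorem exists_norm_sq_le {k : ℕ} [NeZero k] (a b c : Fin k → ℂ) {l : ℂ}
    (hl : l ∉ sigmaDet a b c) : ∃ C : ℝ, 0 ≤ C ∧ ∀ x : EllTwo, ‖x‖ ^ 2 ≤
      C * (‖(toeplitzOp a b c - l • ContinuousLinearMap.id ℂ EllTwo) x‖ ^ 2 +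
        ‖coordCLM 0 x‖ ^ 2) := by
  have hk : 0 < k := Nat.pos_of_neZero k
  obtain ⟨C, hC0, hC⟩ := exists_sum_norm_sq_le a b c hl
  set A := toeplitzOp a b c - l • ContinuousLinearMap.id ℂ EllTwo with hA
  refine ⟨C, hC0, fun x => ?_⟩
  have hfin : ∀ (M : ℕ) (x : EllTwo), (∀ n, M ≤ n → x n = 0) → ‖x‖ ^ 2 ≤
      C * (‖A x‖ ^ 2 + ‖coordCLM 0 x‖ ^ 2) := by
    intro M x hx
    have hle : M ≤ M * k := Nat.le_mul_of_pos_right M hk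
    have h1 := hC M x fun n hn => hx n (hle.trans hn)
    have h2 : ‖x‖ ^ 2 = ∑ n ∈ Finset.range ((M + 1) * k), ‖x n‖ ^ 2 := by
      rw [EllTwo.norm_sq_eq_tsum]
      refine tsum_eq_sum fun n hn => ?_
      rw [Finset.mem_range, not_lt] at hn
      rw [hx n (by nlinarith), norm_zero, zero_pow two_ne_zero]
    rw [h2, coordCLM_apply]
    refine h1.trans ?_
    gcongr
    exact EllTwo.sum_norm_sq_le (A x) _
  -- Truncations converge to `x` and both sides are continuous, so finite support suffices.
  have hlim := (lp.hasSum_single (p := 2) (by norm_num) x).tendsto_sum_nat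
  refine le_of_tendsto_of_tendsto' (hlim.norm.pow 2)
    ((((((A.continuous.tendsto x).comp hlim).norm.pow 2).add
      ((((coordCLM 0).continuous.tendsto x).comp hlim).norm.pow 2))).const_mul C) fun M => ?_
  refine hfin M _ fun n hn => ?_
  rw [← coordCLM_apply, map_sum]
  refine Finset.sum_eq_zero fun j hj => ?_
  rw [coordCLM_apply, lp.single_apply_ne]
  have := Finset.mem_range.1 hj
  omega

theorem tridiagEntry_comm {k : ℕ} [NeZero k] (a b : Fin k → ℂ) (i j : ℕ) :
    tridiagEntry a b b i j = tridiagEntry a b b j i := by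
  unfold tridiagEntry
  split_ifs <;> first | rfl | omega | (subst_vars; rfl)

theorem tridiagMulVec_single {k : ℕ} [NeZero k] (a b c : Fin k → ℂ) (n i : ℕ) :
    tridiagMulVec a b c (lp.single 2 n (1 : ℂ) : EllTwo) i = tridiagEntry a b c i n := by
  rw [tridiagMulVec_eq_sum a b c _ (show i + 2 ≤ i + n + 2 by omega), Finset.sum_eq_single n]
  · rw [lp.single_apply_self, mul_one]
  · intro j _ hj
    rw [lp.single_apply_ne _ _ _ hj, mul_zero]
  · intro h
    simp only [Finset.mem_range] at h
    omega

/-- The orthogonal complement of the range of the complex symmetric operator `T - l` consists of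
the complex conjugates of the elements of its kernel. -/
theorem star_mem_ker {k : ℕ} [NeZero k] (a b : Fin k → ℂ) {l : ℂ} {y : EllTwo}
    (hy : ∀ x, inner ℂ y ((toeplitzOp a b b - l • ContinuousLinearMap.id ℂ EllTwo) x) = 0) :
    star y ∈ (toeplitzOp a b b - l • ContinuousLinearMap.id ℂ EllTwo).ker := by
  rw [mem_ker_iff]
  intro n
  have h := hy (lp.single 2 n (1 : ℂ))
  rw [sub_apply, inner_sub_right, smul_apply,
    ContinuousLinearMap.id_apply, inner_smul_right, lp.inner_single_right, lp.inner_eq_tsum,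
    sub_eq_zero, tsum_eq_sum (s := Finset.range (n + 2))] at h
  · simp only [toeplitzOp_apply, tridiagMulVec_single] at h
    rw [tridiagMulVec]
    simp only [lp.star_apply]
    simp only [RCLike.inner_apply, one_mul] at h
    rw [← starRingEnd_apply, ← h]
    refine Finset.sum_congr rfl fun j _ => ?_
    rw [tridiagEntry_comm]
    rfl
  · intro i hi
    rw [Finset.mem_range, not_lt] at hi
    rw [toeplitzOp_apply, tridiagMulVec_single, tridiagEntry_of_gt _ _ _ (by omega),
      inner_zero_right]

theorem apply_zero_ne_of_mem_ker {k : ℕ} [NeZero k] (a b c : Fin k → ℂ) {l : ℂ}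
    (hl : l ∉ sigmaDet a b c) {x : EllTwo}
    (hx : x ∈ (toeplitzOp a b c - l • ContinuousLinearMap.id ℂ EllTwo).ker) (h0 : x 0 = 0) :
    x = 0 := by
  obtain ⟨C, -, hC⟩ := exists_norm_sq_le a b c hl
  have h := hC x
  rw [LinearMap.mem_ker] at hx
  rw [show (toeplitzOp a b c - l • ContinuousLinearMap.id ℂ EllTwo) x = 0 from hx, coordCLM_apply,
    h0, norm_zero, norm_zero, zero_pow two_ne_zero, add_zero, mul_zero] at h
  exact norm_eq_zero.1 (pow_eq_zero_iff two_ne_zero |>.1 (le_antisymm h (by positivity)))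

/-- On the hyperplane `x 0 = 0` the estimate has no error term. The kernel, and by symmetry the
orthogonal complement of the range, embed in `ℂ` by the coordinate 0. -/
theorem isFredholm_of_notMem_sigmaDet {k : ℕ} [NeZero k] (a b : Fin k → ℂ) {l : ℂ}
    (hl : l ∉ sigmaDet a b b) :
    (toeplitzOp a b b - l • ContinuousLinearMap.id ℂ EllTwo).IsFredholm := by
  obtain ⟨C, hC0, hC⟩ := exists_norm_sq_le a b b hl
  set A := toeplitzOp a b b - l • ContinuousLinearMap.id ℂ EllTwo with hA
  set E : Submodule ℂ EllTwo := (coordCLM 0).ker with hE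
  have hEclosed : IsClosed (E : Set EllTwo) := (coordCLM 0).isClosed_ker
  have hcofg : E.CoFG := Submodule.CoFG.ker _
  have hanti : AntilipschitzWith (Real.sqrt C).toNNReal (A.domRestrict E) := by
    refine AddMonoidHomClass.antilipschitz_of_bound _ fun x => ?_
    have h := hC x
    have hx : coordCLM 0 (x : EllTwo) = 0 := x.2
    rw [hx, norm_zero, zero_pow two_ne_zero, add_zero] at h
    rw [Real.coe_toNNReal _ (Real.sqrt_nonneg _)]
    refine le_of_sq_le_sq ?_ (by positivity)
    rw [mul_pow, Real.sq_sqrt hC0]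
    exact h
  have : CompleteSpace E := hEclosed.completeSpace_coe
  have hemb := hanti.isClosedEmbedding (A.domRestrict E).uniformContinuous
  -- Strictness and closed range carry over from the closed subspace `E` of finite codimension.
  have hstrict := (A.isStrictMap_isClosed_range_iff_restrict E hEclosed).2
    ⟨hemb.isEmbedding.isStrictMap, by
      rw [LinearMap.coe_range]
      exact hemb.isClosed_range⟩
  have hker : FiniteDimensional ℂ A.ker := by
    refine FiniteDimensional.of_injective ((coordCLM 0).toLinearMap.domRestrict A.ker) ?_
    rw [← LinearMap.ker_eq_bot, LinearMap.ker_eq_bot']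
    intro x hx
    refine Subtype.ext (apply_zero_ne_of_mem_ker a b b hl x.2 ?_)
    rw [← coordCLM_apply]
    exact hx
  have horth : FiniteDimensional ℂ (A.rangeᗮ : Submodule ℂ EllTwo) := by
    refine FiniteDimensional.of_injective ((coordCLM 0).toLinearMap.domRestrict A.rangeᗮ) ?_
    rw [← LinearMap.ker_eq_bot, LinearMap.ker_eq_bot']
    intro y hy
    have hy0 : (y : EllTwo) 0 = 0 := by
      rw [← coordCLM_apply]
      exact hy
    have hstar : star (y : EllTwo) ∈ A.ker := star_mem_ker a b fun x =>
      (Submodule.mem_orthogonal' _ _).1 y.2 _ (LinearMap.mem_range_self _ x)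
    have h := apply_zero_ne_of_mem_ker a b b hl hstar (by rw [lp.star_apply, hy0, star_zero])
    exact Subtype.ext (star_eq_zero.1 h)
  refine ⟨hstrict.1, hstrict.2, hker, ?_, Submodule.ClosedComplemented.of_finiteDimensional _⟩
  have : CompleteSpace A.range := hstrict.2.completeSpace_coe
  exact Submodule.FG.cofg_of_isCompl
    (Submodule.isCompl_orthogonal (K := A.range)).symm
    (Module.finite_def.1 horth |> fun h => (Submodule.fg_top _).1 h)

/-- By symmetry the range has trivial orthogonal complement; being closed, it is everything. -/
theorem notMem_spectrum_of_ker_eq_bot {k : ℕ} [NeZero k] (a b : Fin k → ℂ) {l : ℂ}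
    (hl : l ∉ sigmaDet a b b)
    (hker : (toeplitzOp a b b - l • ContinuousLinearMap.id ℂ EllTwo).ker = ⊥) :
    l ∉ spectrum ℂ (toeplitzOp a b b) := by
  have hF := isFredholm_of_notMem_sigmaDet a b hl
  set A := toeplitzOp a b b - l • ContinuousLinearMap.id ℂ EllTwo with hA
  have : CompleteSpace A.range := hF.isClosed_range.completeSpace_coe
  have hrange : A.range = ⊤ := by
    rw [← Submodule.orthogonal_eq_bot_iff, Submodule.eq_bot_iff]
    intro y hy
    have hstar : star y ∈ A.ker := star_mem_ker a b fun x =>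
      (Submodule.mem_orthogonal' _ _).1 hy _ (LinearMap.mem_range_self _ x)
    rw [hker, Submodule.mem_bot] at hstar
    exact star_eq_zero.1 hstar
  have hunit : IsUnit A :=
    ContinuousLinearMap.isUnit_iff_bijective.2 ⟨LinearMap.ker_eq_bot.1 hker,
      LinearMap.range_eq_top.1 hrange⟩
  rw [spectrum.mem_iff, not_not, ← IsUnit.neg_iff, neg_sub]
  exact hunit

theorem isUnit_of_notMem_spectrum {T : EllTwo →L[ℂ] EllTwo} {l : ℂ} (hl : l ∉ spectrum ℂ T) :
    IsUnit (T - l • ContinuousLinearMap.id ℂ EllTwo) := by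
  rw [spectrum.mem_iff, not_not, ← IsUnit.neg_iff, neg_sub] at hl
  exact hl

/-! ### Truncated Bloch waves and the inclusion of `sigmaDet` in the spectrum -/

/-- A nonzero Bloch vector on the unit circle gives approximate eigenvectors: truncations of its
quasi-periodic extension. -/
theorem sigmaDet_subset_spectrum {k : ℕ} [NeZero k] (a b c : Fin k → ℂ) :
    sigmaDet a b c ⊆ spectrum ℂ (toeplitzOp a b c) := by
  have hk : 0 < k := Nat.pos_of_neZero k
  rintro l ⟨z, hz, hdet⟩
  by_contra hl
  obtain ⟨v, hv0, hv⟩ := Matrix.exists_mulVec_eq_zero_iff.2 hdet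
  obtain ⟨i, hi⟩ := Function.ne_iff.1 hv0
  have hz0 : z ≠ 0 := by rintro rfl; simp at hz
  set A := toeplitzOp a b c - l • ContinuousLinearMap.id ℂ EllTwo with hA
  obtain ⟨u, hu⟩ := isUnit_of_notMem_spectrum hl
  set R : EllTwo →L[ℂ] EllTwo := ↑u⁻¹ with hR
  have hRA : ∀ x, R (A x) = x := fun x => by
    have h := congrArg (fun f : EllTwo →L[ℂ] EllTwo => f x) u.inv_mul
    rw [hu] at h
    exact h
  set q := quasiPeriodicExt z v with hq
  have hqn : ∀ n, ‖q n‖ ≤ ∑ j, ‖v j‖ := fun n => by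
    rw [hq, quasiPeriodicExt, norm_mul, norm_pow, norm_inv, hz, inv_one, one_pow, one_mul]
    exact norm_apply_le_sum v _
  have htq := tridiagMulVec_quasiPeriodicExt a b c hz0 hv
  set V := ∑ j, ‖v j‖ with hV
  set B := ∑ j, ‖b j‖ with hB
  set G := ∑ j, ‖c j‖ with hG
  have hV0 : 0 ≤ V := Finset.sum_nonneg fun _ _ => norm_nonneg _
  have hB0 : 0 ≤ B := Finset.sum_nonneg fun _ _ => norm_nonneg _
  have hG0 : 0 ≤ G := Finset.sum_nonneg fun _ _ => norm_nonneg _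
  set D := G * V + B * V + G * V with hD
  -- Cut after `N` blocks, the wave has squared norm at least `N ‖v i‖²`. Its image under `A` lives
  -- at the two ends only and is bounded by `D` for all `N`, which contradicts a bounded inverse.
  have key : ∀ N : ℕ, (N : ℝ) * ‖v i‖ ^ 2 ≤ (‖R‖ * D) ^ 2 := by
    intro N
    rcases Nat.eq_zero_or_pos N with rfl | hN
    · rw [Nat.cast_zero, zero_mul]
      positivity
    obtain ⟨L, hL⟩ : ∃ L, N * k = L + 1 := ⟨N * k - 1, by have := Nat.mul_pos hN hk; omega⟩
    let x : EllTwo := ∑ n ∈ Finset.range (L + 1), lp.single 2 n (q n)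
    have hx : ∀ n, x n = if n < L + 1 then q n else 0 := by
      intro n
      rw [← coordCLM_apply, map_sum]
      simp only [coordCLM_apply, lp.single_apply, Pi.single_apply, Finset.sum_ite_eq,
        Finset.mem_range]
    have hAx : A x = -lp.single 2 0 (z * c (Fin.ofNat k (k - 1)) * v (Fin.ofNat k (k - 1))) +
        -lp.single 2 L (b (Fin.ofNat k L) * q (L + 1)) +
        lp.single 2 (L + 1) (c (Fin.ofNat k L) * q L) := by
      apply lp.ext
      funext n
      have hAn : A x n = tridiagMulVec a b c x n - l * x n := rfl
      have htn := htq n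
      rw [hAn]
      change _ = -(lp.single 2 0 _ : EllTwo) n + -(lp.single 2 L _ : EllTwo) n +
        (lp.single 2 (L + 1) _ : EllTwo) n
      simp only [lp.single_apply, Pi.single_apply]
      cases n with
      | zero =>
        rw [tridiagMulVec_zero] at htn ⊢
        simp only [hx]
        rcases Nat.eq_zero_or_pos L with rfl | hL0
        · simp at htn ⊢
          linear_combination htn
        · simp [hL0, hL0.ne] at htn ⊢
          linear_combination htn
      | succ n =>
        rw [tridiagMulVec_succ] at htn ⊢
        simp only [hx]
        rw [if_neg (Nat.succ_ne_zero n)] at htn ⊢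
        rcases lt_trichotomy (n + 1) L with h | h | h
        · rw [if_pos (by omega), if_pos (by omega), if_pos (by omega), if_neg (by omega),
            if_neg (by omega)]
          linear_combination htn
        · subst h
          rw [if_pos (by omega), if_pos (by omega), if_neg (by omega), if_pos rfl,
            if_neg (by omega)]
          linear_combination htn
        · rw [if_neg (by omega : ¬ n + 1 < L + 1), if_neg (by omega : ¬ n + 2 < L + 1),
            if_neg (by omega : ¬ n + 1 = L)]
          rcases Nat.eq_or_lt_of_le (Nat.succ_le_of_lt h) with h' | h'
          · obtain rfl : L = n := by omega
            rw [if_pos (by omega), if_pos rfl]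
            ring
          · rw [if_neg (by omega), if_neg (by omega)]
            ring
    have hAx_norm : ‖A x‖ ≤ D := by
      rw [hAx, hD]
      refine (norm_add₃_le).trans ?_
      rw [norm_neg, norm_neg, lp.norm_single (by norm_num), lp.norm_single (by norm_num),
        lp.norm_single (by norm_num), norm_mul, norm_mul, norm_mul, norm_mul, hz, one_mul]
      gcongr
      · exact norm_apply_le_sum c _
      · exact norm_apply_le_sum v _
      · exact norm_apply_le_sum b _
      · exact hqn _
      · exact norm_apply_le_sum c _
      · exact hqn _
    have hx_norm : ‖x‖ ≤ ‖R‖ * D := by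
      calc ‖x‖ = ‖R (A x)‖ := by rw [hRA]
        _ ≤ ‖R‖ * ‖A x‖ := R.le_opNorm _
        _ ≤ _ := by gcongr
    have hlow : (N : ℝ) * ‖v i‖ ^ 2 ≤ ‖x‖ ^ 2 := by
      refine le_trans (le_of_eq ?_) (EllTwo.sum_norm_sq_le x
        ((Finset.range N).image fun m => m * k + (i : ℕ)))
      rw [Finset.sum_image]
      · rw [Finset.sum_congr rfl (g := fun _ => ‖v i‖ ^ 2), Finset.sum_const, Finset.card_range,
          nsmul_eq_mul]
        intro m hm
        have hm' := Finset.mem_range.1 hm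
        have hi' := i.isLt
        have : m * k + i < L + 1 := by
          rw [← hL]
          nlinarith [Nat.mul_le_mul_right k (Nat.succ_le_of_lt hm')]
        rw [hx, if_pos this, hq, quasiPeriodicExt_mul_add, norm_mul, norm_pow, norm_inv, hz,
          inv_one, one_pow, one_mul]
      · intro m _ n _ h
        have : m * k = n * k := by simpa using h
        exact Nat.eq_of_mul_eq_mul_right hk this
    exact hlow.trans (by gcongr)
  obtain ⟨N, hN⟩ := exists_nat_gt ((‖R‖ * D) ^ 2 / ‖v i‖ ^ 2)
  have hvi : 0 < ‖v i‖ ^ 2 := by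
    have := norm_pos_iff.2 hi
    positivity
  rw [div_lt_iff₀ hvi] at hN
  exact absurd (key N) (not_le.2 hN)

/-! ### The determinant of the symbol and the set `gammaSet` -/

theorem Matrix.det_add_smul_single {n : Type*} [Fintype n] [DecidableEq n] (A : Matrix n n ℂ)
    (i j : n) (s : ℂ) :
    (A + s • Matrix.single i j (1 : ℂ)).det =
      A.det + s * (A.updateRow i (Pi.single j 1)).det := by
  have h : A + s • Matrix.single i j (1 : ℂ) =
      A.updateRow i (A i + s • (Pi.single j 1 : n → ℂ)) := by
    ext p q
    by_cases hp : p = i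
    · subst hp
      by_cases hq : q = j
      · subst hq; simp
      · simp [hq, Ne.symm hq]
    · simp [hp, Ne.symm hp]
  rw [h, Matrix.det_updateRow_add, Matrix.det_updateRow_smul, Matrix.updateRow_eq_self]

theorem Matrix.exists_det_add_single_add_single {n : Type*} [Fintype n] [DecidableEq n]
    (A : Matrix n n ℂ) (i j i' j' : n) : ∃ p q r m : ℂ, ∀ s t : ℂ,
      (A + t • Matrix.single i' j' (1 : ℂ) + s • Matrix.single i j (1 : ℂ)).det =
        p + q * s + r * t + m * (s * t) := by
  -- Both corner entries lie in the same row exactly when `k = 1` in the application; the mixed term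
  -- is then absent.
  by_cases h : i = i'
  · subst h
    refine ⟨A.det, (A.updateRow i (Pi.single j 1)).det, (A.updateRow i (Pi.single j' 1)).det, 0,
      fun s t => ?_⟩
    have hrow : (A + t • Matrix.single i j' (1 : ℂ)).updateRow i (Pi.single j 1) =
        A.updateRow i (Pi.single j 1) := by
      ext p q
      by_cases hp : p = i
      · subst hp; simp
      · simp [hp, Ne.symm hp]
    rw [Matrix.det_add_smul_single, Matrix.det_add_smul_single, hrow]
    ring
  · refine ⟨A.det, (A.updateRow i (Pi.single j 1)).det, (A.updateRow i' (Pi.single j' 1)).det,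
      ((A.updateRow i (Pi.single j 1)).updateRow i' (Pi.single j' 1)).det, fun s t => ?_⟩
    have hrow : (A + t • Matrix.single i' j' (1 : ℂ)).updateRow i (Pi.single j 1) =
        A.updateRow i (Pi.single j 1) + t • Matrix.single i' j' (1 : ℂ) := by
      ext p q
      by_cases hp : p = i
      · subst hp; simp [Ne.symm h]
      · simp [hp]
    rw [Matrix.det_add_smul_single, Matrix.det_add_smul_single, hrow, Matrix.det_add_smul_single]
    ring

theorem ofNat_pred_val {k : ℕ} [NeZero k] : ((Fin.ofNat k (k - 1) : Fin k) : ℕ) = k - 1 := by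
  simp [Nat.mod_eq_of_lt (show k - 1 < k from Nat.sub_one_lt (NeZero.ne k))]

theorem blockOne_eq {k : ℕ} [NeZero k] (a b c : Fin k → ℂ) :
    blockOne a b c = c (Fin.ofNat k (k - 1)) • Matrix.single 0 (Fin.ofNat k (k - 1)) (1 : ℂ) := by
  ext i j
  have hi := i.isLt
  have hj := j.isLt
  rw [blockOne, Matrix.of_apply, Matrix.smul_apply, Matrix.single_apply, tridiagEntry,
    if_neg (by omega), if_neg (by omega)]
  by_cases h : k + (i : ℕ) = j + 1
  · have h1 : 0 = i := Fin.ext (by simp; omega)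
    have h2 : Fin.ofNat k (k - 1) = j := Fin.ext (by rw [ofNat_pred_val]; omega)
    rw [if_pos h, if_pos ⟨h1, h2⟩, ofNat_val, h2, smul_eq_mul, mul_one]
  · rw [if_neg h, if_neg, smul_zero]
    rintro ⟨rfl, rfl⟩
    apply h
    rw [ofNat_pred_val]
    simp
    omega

theorem blockNegOne_eq_transpose {k : ℕ} [NeZero k] (a b : Fin k → ℂ) :
    blockNegOne a b b = (blockOne a b b)ᵀ := by
  ext i j
  exact tridiagEntry_comm a b _ _

theorem blockZero_transpose {k : ℕ} [NeZero k] (a b : Fin k → ℂ) :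
    (blockZero a b b)ᵀ = blockZero a b b := by
  ext i j
  exact tridiagEntry_comm a b _ _

/-- For a symmetric matrix, inverting `z` transposes the symbol. -/
theorem det_symbol_inv {k : ℕ} [NeZero k] (a b : Fin k → ℂ) (l z : ℂ) :
    (symbol a b b z⁻¹ - l • (1 : Matrix (Fin k) (Fin k) ℂ)).det =
      (symbol a b b z - l • (1 : Matrix (Fin k) (Fin k) ℂ)).det := by
  rw [← Matrix.det_transpose]
  congr 1
  rw [symbol, symbol, blockNegOne_eq_transpose, Matrix.transpose_sub, Matrix.transpose_add,
    Matrix.transpose_add, Matrix.transpose_smul, Matrix.transpose_smul, Matrix.transpose_smul,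
    Matrix.transpose_one, Matrix.transpose_transpose, blockZero_transpose, inv_inv]
  abel

/-- For a symmetric matrix the determinant of `f(z) - l` is `α (z + z⁻¹) + β`. -/
theorem exists_det_symbol_eq {k : ℕ} [NeZero k] (a b : Fin k → ℂ) (l : ℂ) : ∃ α β : ℂ,
    ∀ z : ℂ, z ≠ 0 → (symbol a b b z - l • (1 : Matrix (Fin k) (Fin k) ℂ)).det =
      α * (z + z⁻¹) + β := by
  obtain ⟨p, q, r, m, h⟩ := Matrix.exists_det_add_single_add_single
    (blockZero a b b - l • (1 : Matrix (Fin k) (Fin k) ℂ))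
    0 (Fin.ofNat k (k - 1)) (Fin.ofNat k (k - 1)) 0
  set d := b (Fin.ofNat k (k - 1)) with hd
  have hdet : ∀ z : ℂ, z ≠ 0 → (symbol a b b z - l • (1 : Matrix (Fin k) (Fin k) ℂ)).det =
      p + q * d * z + r * d * z⁻¹ + m * d ^ 2 := by
    intro z hz
    have e : symbol a b b z - l • (1 : Matrix (Fin k) (Fin k) ℂ) =
        blockZero a b b - l • (1 : Matrix (Fin k) (Fin k) ℂ) +
          (z⁻¹ * d) • Matrix.single (Fin.ofNat k (k - 1)) 0 (1 : ℂ) +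
          (z * d) • Matrix.single 0 (Fin.ofNat k (k - 1)) (1 : ℂ) := by
      rw [symbol, blockNegOne_eq_transpose, blockOne_eq, Matrix.transpose_smul,
        Matrix.transpose_single, smul_smul, smul_smul]
      abel
    rw [e, h]
    field_simp
  -- Comparing the values at 2 and 1/2 already forces equal coefficients of `z` and `z⁻¹`.
  have hqr : q * d = r * d := by
    have h2 := det_symbol_inv a b l 2
    rw [hdet 2 two_ne_zero, hdet 2⁻¹ (inv_ne_zero two_ne_zero), inv_inv] at h2
    linear_combination (-2 / 3 : ℂ) * h2
  refine ⟨q * d, p + m * d ^ 2, fun z hz => ?_⟩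
  rw [hdet z hz, hqr]
  ring

/-- The sequences annihilated by all rows of the tridiagonal matrix minus `l` except the first. -/
def interiorSolutions {k : ℕ} [NeZero k] (a b c : Fin k → ℂ) (l : ℂ) : Submodule ℂ (ℕ → ℂ) where
  carrier := {x | ∀ n, tridiagMulVec a b c x (n + 1) = l * x (n + 1)}
  add_mem' {x y} hx hy n := by
    change tridiagMulVec a b c (fun n => x n + y n) (n + 1) = l * (x (n + 1) + y (n + 1))
    rw [tridiagMulVec_add, hx, hy, mul_add]
  zero_mem' n := by simp [tridiagMulVec]
  smul_mem' r x hx n := by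
    change tridiagMulVec a b c (fun n => r * x n) (n + 1) = l * (r * x (n + 1))
    rw [tridiagMulVec_smul, hx]
    ring

theorem eq_zero_of_mem_interiorSolutions {k : ℕ} [NeZero k] {a b c : Fin k → ℂ} {l : ℂ}
    (hb : ∀ i, b i ≠ 0) {x : ℕ → ℂ} (hx : x ∈ interiorSolutions a b c l) (h0 : x 0 = 0)
    (h1 : x 1 = 0) : x = 0 := by
  have key : ∀ n, x n = 0 ∧ x (n + 1) = 0 := by
    intro n
    induction n with
    | zero => exact ⟨h0, h1⟩
    | succ n ih =>
      refine ⟨ih.2, ?_⟩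
      have h := hx n
      rw [tridiagMulVec_succ, ih.1, ih.2, mul_zero, mul_zero, mul_zero, zero_add, zero_add] at h
      exact (mul_eq_zero.1 h).resolve_left (hb _)
  exact funext fun n => (key n).1

theorem finrank_le_of_linearIndependent_interiorSolutions {k : ℕ} [NeZero k] {a b c : Fin k → ℂ}
    {l : ℂ} (hb : ∀ i, b i ≠ 0) {m : ℕ} {u : Fin m → ℕ → ℂ}
    (hu : ∀ i, u i ∈ interiorSolutions a b c l) (hli : LinearIndependent ℂ u) : m ≤ 2 := by
  let φ : interiorSolutions a b c l →ₗ[ℂ] (Fin 2 → ℂ) :=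
    (LinearMap.funLeft ℂ ℂ (fun i : Fin 2 => (i : ℕ))).domRestrict _
  have hφ : LinearMap.ker φ = ⊥ := by
    rw [LinearMap.ker_eq_bot']
    intro x hx
    exact Subtype.ext (eq_zero_of_mem_interiorSolutions hb x.2 (congrFun hx 0) (congrFun hx 1))
  have hli' : LinearIndependent ℂ fun i => (⟨u i, hu i⟩ : interiorSolutions a b c l) :=
    LinearIndependent.of_comp (interiorSolutions a b c l).subtype hli
  simpa using (hli'.map' φ hφ).fintype_card_le_finrank

theorem quasiPeriodicExt_ne_zero {k : ℕ} [NeZero k] (z : ℂ) {v : Fin k → ℂ} (hv : v ≠ 0) :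
    quasiPeriodicExt z v ≠ 0 := by
  intro h
  exact hv (funext fun i => by rw [← quasiPeriodicExt_val z v i, h]; rfl)

/-- Otherwise three values of `z` would give Bloch waves that are eigenvectors of the period shift
with distinct eigenvalues. These are independent, but the solution space of the three-term
recurrence has dimension at most 2. -/
theorem exists_det_symbol_ne_zero {k : ℕ} [NeZero k] {a b c : Fin k → ℂ} (l : ℂ)
    (hb : ∀ i, b i ≠ 0) :
    ∃ z : ℂ, z ≠ 0 ∧ (symbol a b c z - l • (1 : Matrix (Fin k) (Fin k) ℂ)).det ≠ 0 := by
  by_contra! hdet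
  let ζ : Fin 3 → ℂ := fun i => ((i : ℕ) : ℂ) + 1
  have hζ : ∀ i, ζ i ≠ 0 := fun i => Nat.cast_add_one_ne_zero _
  choose v hv0 hv using fun i => Matrix.exists_mulVec_eq_zero_iff.2 (hdet (ζ i) (hζ i))
  have hli : LinearIndependent ℂ fun i => quasiPeriodicExt (ζ i) (v i) := by
    refine Module.End.eigenvectors_linearIndependent'
      (LinearMap.funLeft ℂ ℂ fun n : ℕ => n + k) (fun i => (ζ i)⁻¹) ?_ _ fun i => ⟨?_, ?_⟩
    · intro i j h
      have := inv_injective h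
      simp only [ζ, add_left_inj, Nat.cast_inj] at this
      exact Fin.ext this
    · rw [Module.End.mem_eigenspace_iff]
      funext n
      exact quasiPeriodicExt_add _ _ n
    · exact quasiPeriodicExt_ne_zero _ (hv0 i)
  have h3 := finrank_le_of_linearIndependent_interiorSolutions (a := a) (c := c) (l := l) hb
    (fun i n => by
      rw [tridiagMulVec_quasiPeriodicExt a b c (hζ i) (hv i), if_neg (Nat.succ_ne_zero n),
        sub_zero]) hli
  omega

/-- If `w` is a zero of `α (z + z⁻¹) + β`, so is `w⁻¹`. For `‖w‖ = 1` these two roots have equal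
modulus; `α = 0` would make the determinant vanish identically. -/
theorem sigmaDet_subset_gammaSet {k : ℕ} [NeZero k] {a b : Fin k → ℂ} (hb : ∀ i, b i ≠ 0) :
    sigmaDet a b b ⊆ gammaSet a b b := by
  rintro l ⟨w, hw, hdet⟩
  have hw0 : w ≠ 0 := by rintro rfl; simp at hw
  obtain ⟨α, β, h⟩ := exists_det_symbol_eq a b l
  rw [h w hw0] at hdet
  have hα : α ≠ 0 := by
    rintro rfl
    obtain ⟨z, hz, hne⟩ := exists_det_symbol_ne_zero (a := a) (c := b) l hb
    rw [h z hz, zero_mul, zero_add] at hne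
    rw [zero_mul, zero_add] at hdet
    exact hne hdet
  refine ⟨w, w⁻¹, α, hα, fun z hz => ?_, by rw [norm_inv, hw, inv_one]⟩
  have h1 : w * w⁻¹ = 1 := mul_inv_cancel₀ hw0
  have h2 : z * z⁻¹ = 1 := mul_inv_cancel₀ hz
  rw [h z hz]
  linear_combination z * hdet + α * h2 - α * h1

/-! ### Terminating Bloch vectors and edge modes -/

theorem exists_isTerminatingBloch {k : ℕ} [NeZero k] {a b : Fin k → ℂ} (hb : ∀ i, b i ≠ 0) {l : ℂ}
    (hl : l ∈ spectrum ℂ (leadingBlock a b b)) :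
    ∃ (z : ℂ) (v : Fin k → ℂ), IsTerminatingBloch a b b l z v := by
  obtain ⟨u, hu0, hu⟩ := (Matrix.mem_spectrum_iff_exists_mulVec _ _).1 hl
  obtain ⟨i, hi⟩ := Function.ne_iff.1 hu0
  obtain ⟨N, hN⟩ : ∃ N, k = N + 2 := ⟨k - 2, by have := i.isLt; omega⟩
  let x : ℕ → ℂ := fun n => if h : n < k - 1 then u ⟨n, h⟩ else 0
  have hxu : ∀ j : Fin (k - 1), x j = u j := fun j => dif_pos j.isLt
  have hlast : x (N + 1) = 0 := dif_neg (by omega)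
  have hrow : ∀ n < N + 1, tridiagMulVec a b b x n = l * x n := by
    intro n hn
    have h := leadingBlock_mulVec a b b (x := x) (by rw [hN]; exact hlast) ⟨n, by omega⟩
    rw [← h, show (fun j : Fin (k - 1) => x j) = u from funext hxu, hu]
    exact congrArg (l * ·) (hxu ⟨n, by omega⟩).symm
  have hxi : x i ≠ 0 := by
    rw [hxu]
    exact hi
  -- If `x 0 = 0`, the recurrence run forwards kills the eigenvector. Run backwards from `x (N + 1)
  -- = 0`, it shows that `x N = 0` would force `x 0 = 0`.
  have h0 : x 0 ≠ 0 := by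
    intro h0
    have key : ∀ n, n < N + 1 → x n = 0 ∧ x (n + 1) = 0 := by
      intro n
      induction n with
      | zero =>
        intro hn
        have h := hrow 0 hn
        rw [tridiagMulVec_zero, h0, mul_zero, mul_zero, zero_add] at h
        exact ⟨h0, (mul_eq_zero.1 h).resolve_left (hb _)⟩
      | succ n ih =>
        intro hn
        obtain ⟨h1, h2⟩ := ih (by omega)
        have h := hrow (n + 1) hn
        rw [tridiagMulVec_succ, h1, h2, mul_zero, mul_zero, mul_zero, zero_add, zero_add] at h
        exact ⟨h2, (mul_eq_zero.1 h).resolve_left (hb _)⟩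
    exact hxi (key i (by have := i.isLt; omega)).1
  have hpen : x N ≠ 0 := by
    intro hpen
    have key : ∀ j, j ≤ N → x (N - j) = 0 ∧ x (N - j + 1) = 0 := by
      intro j
      induction j with
      | zero => exact fun _ => ⟨hpen, hlast⟩
      | succ j ih =>
        intro hj
        obtain ⟨h1, h2⟩ := ih (by omega)
        rw [show N - j = N - (j + 1) + 1 by omega] at h1 h2
        have h := hrow (N - (j + 1) + 1) (by omega)
        rw [tridiagMulVec_succ, h1, h2, mul_zero, mul_zero, mul_zero, add_zero, add_zero] at h
        exact ⟨(mul_eq_zero.1 h).resolve_left (hb _), h1⟩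
    have h := (key N le_rfl).1
    rw [Nat.sub_self] at h
    exact h0 h
  -- The solution of the last row `b_N x_N + b_{N+1} z⁻¹ x_0 = 0`, the diagonal term being 0.
  set z : ℂ := -(b (Fin.ofNat k (N + 1)) * x 0) / (b (Fin.ofNat k N) * x N) with hz
  have hz0 : z ≠ 0 := div_ne_zero (neg_ne_zero.2 (mul_ne_zero (hb _) h0)) (mul_ne_zero (hb _) hpen)
  have hpred : ((Fin.ofNat k (k - 1) : Fin k) : ℕ) = N + 1 := by rw [ofNat_pred_val]; omega
  refine ⟨z, fun j => x j, hz0, fun h => h0 (congrFun h 0), ?_, ?_⟩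
  · have hq : ∀ n, n < k → quasiPeriodicExt z (fun j : Fin k => x j) n = x n :=
      fun n hn => quasiPeriodicExt_val z _ ⟨n, hn⟩
    funext j
    have hj := j.isLt
    rw [symbol_sub_mulVec, hpred, hlast, mul_zero, ite_self, add_zero, Pi.zero_apply, sub_eq_zero]
    rcases Nat.lt_or_ge j (N + 1) with hjN | hjN
    · rw [← hrow j hjN]
      exact tridiagMulVec_congr a b b fun n _ hn => hq n (by omega)
    · have hjeq : (j : ℕ) = N + 1 := by omega
      have hk2 := quasiPeriodicExt_add z (fun j : Fin k => x j) 0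
      rw [zero_add, hq 0 (by omega)] at hk2
      rw [hjeq, tridiagMulVec_succ, hq N (by omega), hq (N + 1) (by omega), ← hN, hk2, hlast,
        hz]
      have h1 := hb (Fin.ofNat k (N + 1))
      have h2 := hb (Fin.ofNat k N)
      field_simp
      ring
  · change x (k - 1) = 0
    rw [hN]
    exact hlast

theorem IsTerminatingBloch.exists_isEdgeMode {k : ℕ} [NeZero k] {a b : Fin k → ℂ} {l z : ℂ}
    {v : Fin k → ℂ} (hl : l ∉ sigmaDet a b b) (h : IsTerminatingBloch a b b l z v)
    (hz : 1 < ‖z‖) :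
    ∃ w : EllTwo, (∀ n, w n = quasiPeriodicExt z v n) ∧ IsEdgeMode (toeplitzOp a b b) l w := by
  obtain ⟨hz0, hv0, hv, hlast⟩ := h
  have hr : ‖z⁻¹‖ < 1 := by
    rw [norm_inv]
    exact inv_lt_one_of_one_lt₀ hz
  obtain ⟨C, ρ, hρ0, hρ1, hbd⟩ :=
    exists_exp_bound (Nat.pos_of_neZero k) hr (quasiPeriodicExt_add z v)
  have hpred : v (Fin.ofNat k (k - 1)) = 0 := by
    rw [← hlast]
    exact congrArg v (Fin.ext ofNat_pred_val)
  refine ⟨⟨quasiPeriodicExt z v, memℓp_of_exp_bound hρ0 hρ1 hbd⟩, fun _ => rfl, fun h => ?_,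
    not_not.2 (isFredholm_of_notMem_sigmaDet a b hl), ?_, C, ρ, hρ0, hρ1, hbd⟩
  · exact quasiPeriodicExt_ne_zero z hv0 (congrArg Subtype.val h)
  · rw [apply_eq_smul_iff]
    intro n
    have hn := tridiagMulVec_quasiPeriodicExt a b b hz0 hv n
    rw [hpred, mul_zero, ite_self, sub_zero] at hn
    exact hn

/-! ### Edge eigenvalues and the spectrum -/

theorem sigmaEdge_subset_spectrum (T : EllTwo →L[ℂ] EllTwo) : sigmaEdge T ⊆ spectrum ℂ T := by
  rintro l ⟨w, hw0, -, hw, -⟩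
  by_contra hl
  have hinj := (ContinuousLinearMap.isUnit_iff_bijective.1 (isUnit_of_notMem_spectrum hl)).1
  refine hw0 (hinj ?_)
  rw [map_zero]
  exact sub_eq_zero.2 hw

theorem sigmaEdge_subset_spectrum_leadingBlock {k : ℕ} [NeZero k] (a b : Fin k → ℂ) :
    sigmaEdge (toeplitzOp a b b) ⊆ spectrum ℂ (leadingBlock a b b) := by
  rintro l ⟨w, hw0, hess, hw, -⟩
  exact mem_spectrum_leadingBlock a b (not_not.1 hess).finite_ker
    ((apply_eq_smul_iff a b b l w).1 hw) hw0

theorem spectrum_subset {k : ℕ} [NeZero k] (a b : Fin k → ℂ) :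
    spectrum ℂ (toeplitzOp a b b) ⊆ sigmaDet a b b ∪ sigmaEdge (toeplitzOp a b b) := by
  intro l hl
  refine or_iff_not_imp_left.2 fun hdet => ?_
  have hF := isFredholm_of_notMem_sigmaDet a b hdet
  obtain ⟨w, hw, hw0⟩ := Submodule.exists_mem_ne_zero_of_ne_bot
    fun h => notMem_spectrum_of_ker_eq_bot a b hdet h hl
  rw [mem_ker_iff] at hw
  exact ⟨w, hw0, not_not.2 hF, (apply_eq_smul_iff a b b l w).2 hw,
    exists_exp_bound_of_mem_ker a b hF.finite_ker hw hw0⟩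

theorem mainTheorem1 {k : ℕ} [NeZero k] (a b c : Fin k → ℂ) (hsymm : ∀ i, b i = c i) :
    -- (i) existence of the Floquet parameter and of the Bloch vector
    ((∀ i, b i ≠ 0) →
      ∀ l ∈ spectrum ℂ (leadingBlock a b c) \ gammaSet a b c,
        ∃ (z : ℂ) (v : Fin k → ℂ), IsTerminatingBloch a b c l z v) ∧
    -- (ii) edge eigenvalues
    ((∀ i, b i ≠ 0) →
      ∀ l ∈ spectrum ℂ (leadingBlock a b c) \ gammaSet a b c,
        ∀ (z : ℂ) (v : Fin k → ℂ), IsTerminatingBloch a b c l z v → 1 < ‖z‖ →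
          l ∈ sigmaEdge (toeplitzOp a b c) ∧
          ∃ w : EllTwo, (∀ n, w n = quasiPeriodicExt z v n) ∧
            IsEdgeMode (toeplitzOp a b c) l w) ∧
    -- (iii) the spectrum of the operator
    (sigmaEdge (toeplitzOp a b c) ⊆ spectrum ℂ (toeplitzOp a b c) ∧
      sigmaEdge (toeplitzOp a b c) ⊆ spectrum ℂ (leadingBlock a b c) ∧
      spectrum ℂ (toeplitzOp a b c) =
        sigmaDet a b c ∪ sigmaEdge (toeplitzOp a b c)) := by
  obtain rfl : b = c := funext hsymm
  refine ⟨fun hb l hl => exists_isTerminatingBloch hb hl.1, fun hb l hl z v hv hz => ?_,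
    sigmaEdge_subset_spectrum _, sigmaEdge_subset_spectrum_leadingBlock a b,
    (spectrum_subset a b).antisymm
      (Set.union_subset (sigmaDet_subset_spectrum a b b) (sigmaEdge_subset_spectrum _))⟩
  obtain ⟨w, hw, hmode⟩ :=
    hv.exists_isEdgeMode (fun h => hl.2 (sigmaDet_subset_gammaSet hb h)) hz
  exact ⟨⟨w, hmode⟩, w, hw, hmode⟩
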